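/- Let $G$ be a group, $S\subset G$ a finite generating set and $G^+$ the submonoid generated by $S$. Suppose that $(G,S)$ is a Garside system: $G^+$ is an lcm monoid (Noetherian, cancellative, with right and left lcm's of any two elements), $G$ is its group of fractions, and there is $\Delta\in G^+$ whose set of left divisors in $G^+$ and whose set of right divisors in $G^+$ both equal $S$. Suppose that it is of spindle type: for all $a,b\in S$ the left gcd $a\wedge b$ and the right gcd of $a,b$ lie in $\{a,b,1\}$. Write $a\preceq b$ if $a^{-1}b\in G^+$, $\tau(a)=\Delta^{-1}a\Delta$, $\partial(s)=s^{-1}\Delta$ for $s\in S$, $\inf(a)=\max\{k\in\mathbb Z:\Delta^k\preceq a\}$, $\sup(a)=\min\{k\in\mathbb Z:a\preceq\Delta^k\}$. Every $a\in G$ has a unique left normal form $a=\Delta^{p}s_1\cdots s_l$ with $p=\inf(a)$, $s_i\in S\setminus\{1\}$, $s_i=\Delta\wedge(s_i\cdots s_l)$; put $cl(a)=l$. For $l\ge1$, cycling and decycling are $$c(a)=\Delta^p s_2\cdots s_l\,\tau^{-p}(s_1),\qquad d(a)=\Delta^p\,\tau^p(s_l)\,s_1\cdots s_{l-1},$$ and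 $a$ is called rigid if $\tau^{-p}(s_1)\wedge\partial(s_l)=1$. Let $\mathrm{ord}(a)$ be the least $n\ge1$ with $\tau^n(a)=a$. The super summit set $SSS(b)$ is the set of conjugates $x$ of $b$ with $\Delta^{P}\preceq x\preceq\Delta^{Q}$, where $P$ is the maximum of $\inf$ and $Q$ the minimum of $\sup$ on the conjugacy class of $b$. The SSS-graph of $b$ has vertex set $SSS(b)$ and an arrow labelled $s$ from $x$ to $s^{-1}xs$ whenever $s\in S$ and $x,\,s^{-1}xs\in SSS(b)$. **Proposition.** Let $b\in SSS(b)$, $p=\inf(b)$, $l=cl(b)$, $r=\mathrm{ord}(b)$. Assume $l\ge1$ and, if $l=1$, that $b$ is rigid. Put $m=l\cdot\mathrm{lcm}(|p|,r)/|p|$ if $p\neq0$ and $m=l$ if $p=0$. Then $m,r\ge 1$ (in particular $\mathrm{ord}(b)$ is finite), and: (a) The SSS-graph of $b$ is a quotient of the toroidal grid $\mathbb Z/m\times\mathbb Z/r$: there is a map $\varphi:\mathbb Z/m\times\mathbb Z/r\to G$ with image $SSS(b)$, given by $\varphi(i,j)=c^i(\tau^j(b))$ for $i,j\ge0$, such that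 for all $(i,j)$ $$\varphi(i+1,j)=c(\varphi(i,j)),\quad \varphi(i,j)=d(\varphi(i+1,j)),\quad \varphi(i,j+1)=\tau(\varphi(i,j)),\quad \varphi(i+l,j)=\varphi(i,j-p).$$ The arrows of the SSS-graph starting at $x=\varphi(i,j)$ are exactly: the loop labelled $1$; the horizontal arrow labelled $\Delta$, ending at $\varphi(i,j+1)=\tau(x)$; the vertical arrow labelled $\tau^{-p}(s_1)$, ending at $\varphi(i+1,j)=c(x)$; and the arrow labelled $\partial(s_l)$, ending at $\varphi(i-1,j+1)=\tau(d(x))$ (decycling followed by $\tau$). Here $s_1$ and $s_l$ are the first and last factors of the left normal form of $x$. (b) $SSS(b)$ is finite and $|SSS(b)|\le l\cdot r=cl(b)\cdot\mathrm{ord}(b)$. -/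

import Mathlib

namespace Garside

section Monoids

variable {M : Type*} [Monoid M]

/-- `m` is a least common right multiple of `a` and `b`. Here `a ∣ b` is left divisibility,
`∃ c, b = a * c`. -/
def IsRightLcm (a b m : M) : Prop :=
  a ∣ m ∧ b ∣ m ∧ ∀ c, a ∣ c → b ∣ c → m ∣ c

/-- `m` is a least common left multiple of `a` and `b`. Here `a ∣ᵣ b` is right divisibility,
`∃ c, b = c * a`. -/
def IsLeftLcm (a b m : M) : Prop :=
  a ∣ᵣ m ∧ b ∣ᵣ m ∧ ∀ c, a ∣ᵣ c → b ∣ᵣ c → m ∣ᵣ c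

end Monoids

/-- An lcm monoid: a Noetherian (atomic) cancellative monoid in which any two elements have a
right lcm and a left lcm. -/
structure IsLcmMonoid (M : Type*) [Monoid M] : Prop where
  noetherian : ∀ a : M, ∃ n : ℕ, ∀ L : List M, (∀ x ∈ L, x ≠ 1) → L.prod = a → L.length ≤ n
  cancel : ∀ a b b' c : M, a * b * c = a * b' * c → b = b'
  right_lcm : ∀ a b : M, ∃ m, IsRightLcm a b m
  left_lcm : ∀ a b : M, ∃ m, IsLeftLcm a b m

section Groups

variable {G : Type*} [Group G]

/-- The submonoid `G⁺` of `G` generated by `S`. -/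
def posMonoid (S : Set G) : Submonoid G := Submonoid.closure S

/-- `(G, S)` is a Garside system with Garside element `Δ`: the monoid `G⁺` generated by `S` is an
lcm monoid, `G` is its group of (right and left) fractions, and `Δ ∈ G⁺` is balanced, its set of
left divisors and its set of right divisors in `G⁺` both being the finite set `S`, which
generates `G`. -/
structure IsGarsideSystem (S : Set G) (Δ : G) : Prop where
  lcmMonoid : IsLcmMonoid (posMonoid S)
  right_fractions : ∀ g : G, ∃ a ∈ posMonoid S, ∃ b ∈ posMonoid S, g = a * b⁻¹
  left_fractions : ∀ g : G, ∃ a ∈ posMonoid S, ∃ b ∈ posMonoid S, g = a⁻¹ * b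
  delta_mem : Δ ∈ posMonoid S
  eq_leftDivisors : S = {s | s ∈ posMonoid S ∧ ∃ c ∈ posMonoid S, Δ = s * c}
  eq_rightDivisors : S = {s | s ∈ posMonoid S ∧ ∃ c ∈ posMonoid S, Δ = c * s}
  finite : S.Finite
  generates : Subgroup.closure S = ⊤

/-- The extension of left divisibility in `G⁺` to a relation on `G`:
`a ≼ b` iff `b = a * c` for some `c ∈ G⁺`. -/
def LeftLE (S : Set G) (a b : G) : Prop := ∃ c ∈ posMonoid S, b = a * c

/-- The extension of right divisibility in `G⁺` to a relation on `G`: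
`b ≽ a` iff `b = c * a` for some `c ∈ G⁺`. -/
def RightLE (S : Set G) (a b : G) : Prop := ∃ c ∈ posMonoid S, b = c * a

/-- `d = a ∧ b`, the greatest common left divisor in `G⁺`. -/
def IsLeftGcd (S : Set G) (a b d : G) : Prop :=
  d ∈ posMonoid S ∧ LeftLE S d a ∧ LeftLE S d b ∧
    ∀ e ∈ posMonoid S, LeftLE S e a → LeftLE S e b → LeftLE S e d

/-- `d` is the greatest common right divisor of `a` and `b` in `G⁺`. -/
def IsRightGcd (S : Set G) (a b d : G) : Prop :=
  d ∈ posMonoid S ∧ RightLE S d a ∧ RightLE S d b ∧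
    ∀ e ∈ posMonoid S, RightLE S e a → RightLE S e b → RightLE S e d

/-- A Garside system of spindle type: for simple elements `a, b`, the left gcd and the right gcd
of `a` and `b` lie in `{a, b, 1}`. -/
structure IsSpindle (S : Set G) (Δ : G) : Prop extends IsGarsideSystem S Δ where
  left_gcd : ∀ a ∈ S, ∀ b ∈ S, ∃ d, IsLeftGcd S a b d ∧ (d = a ∨ d = b ∨ d = 1)
  right_gcd : ∀ a ∈ S, ∀ b ∈ S, ∃ d, IsRightGcd S a b d ∧ (d = a ∨ d = b ∨ d = 1)

/-- The inner automorphism `τ : a ↦ Δ⁻¹ * a * Δ`. -/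
def tau (Δ : G) : MulAut G := MulAut.conj Δ⁻¹

/-- The order of `b`: the least `n ≥ 1` with `τ ^ n b = b`. -/
noncomputable def ord (Δ b : G) : ℕ := Function.minimalPeriod (tau Δ) b

/-- `inf b`, the greatest `k` with `Δ ^ k ≼ b`. -/
noncomputable def infimum (S : Set G) (Δ b : G) : ℤ := sSup {k : ℤ | LeftLE S (Δ ^ k) b}

/-- `sup b`, the least `k` with `b ≼ Δ ^ k`. -/
noncomputable def supremum (S : Set G) (Δ b : G) : ℤ := sInf {k : ℤ | LeftLE S b (Δ ^ k)}

/-- `s₁, …, s_l` is a left normal form: each `s_i` is a nontrivial simple element and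
`s_i = Δ ∧ (s_i ⋯ s_l)`. -/
def IsLeftNormal (S : Set G) (Δ : G) : List G → Prop
  | [] => True
  | s :: L => s ∈ S ∧ s ≠ 1 ∧ IsLeftGcd S Δ (s * L.prod) s ∧ IsLeftNormal S Δ L

open Classical in
/-- The factors `s₁, …, s_l` of the left `Δ`-normal form `b = Δ ^ (inf b) * s₁ ⋯ s_l`. -/
noncomputable def factors (S : Set G) (Δ b : G) : List G :=
  if h : ∃ L, IsLeftNormal S Δ L ∧ b = Δ ^ infimum S Δ b * L.prod then h.choose else []

/-- The canonical length `cl b`: the number of factors of the left `Δ`-normal form. -/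
noncomputable def cl (S : Set G) (Δ b : G) : ℕ := (factors S Δ b).length

/-- The first factor `s₁` of the left normal form (`1` if there is none). -/
noncomputable def firstFactor (S : Set G) (Δ b : G) : G := (factors S Δ b).headD 1

/-- The last factor `s_l` of the left normal form (`1` if there is none). -/
noncomputable def lastFactor (S : Set G) (Δ b : G) : G := (factors S Δ b).getLastD 1

/-- Cycling: `c (Δ ^ p * s₁ ⋯ s_l) = Δ ^ p * s₂ ⋯ s_l * τ ^ (-p) s₁`. -/
noncomputable def cycling (S : Set G) (Δ b : G) : G :=
  Δ ^ infimum S Δ b * (factors S Δ b).tail.prod *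
    (tau Δ ^ (-infimum S Δ b)) (firstFactor S Δ b)

/-- Decycling: `d (Δ ^ p * s₁ ⋯ s_l) = Δ ^ p * τ ^ p s_l * s₁ ⋯ s_{l-1}`. -/
noncomputable def decycling (S : Set G) (Δ b : G) : G :=
  Δ ^ infimum S Δ b * (tau Δ ^ infimum S Δ b) (lastFactor S Δ b) *
    (factors S Δ b).dropLast.prod

/-- The right complement `∂ s` of a simple element, `s * ∂ s = Δ`. -/
def compl (Δ s : G) : G := s⁻¹ * Δ

/-- `b = Δ ^ p * s₁ ⋯ s_l` is rigid: `τ ^ (-p) s₁ ∧ ∂ s_l = 1`. -/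
def IsRigid (S : Set G) (Δ b : G) : Prop :=
  IsLeftGcd S ((tau Δ ^ (-infimum S Δ b)) (firstFactor S Δ b)) (compl Δ (lastFactor S Δ b)) 1

/-- The super summit set of `b`: the conjugates `x` of `b` with `Δ ^ p ≼ x ≼ Δ ^ q`, where `p` is
the maximum of `inf` and `q` the minimum of `sup` on the conjugacy class of `b`. -/
def SSS (S : Set G) (Δ b : G) : Set G :=
  {x | IsConj b x ∧ ∃ p q : ℤ,
    IsGreatest (infimum S Δ '' {y | IsConj b y}) p ∧
    IsLeast (supremum S Δ '' {y | IsConj b y}) q ∧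
    LeftLE S (Δ ^ p) x ∧ LeftLE S x (Δ ^ q)}

/-- The labelled arrows `x → y` of the SSS-graph of `b`: its vertices are the elements of `SSS b`,
and there is an arrow with label `s` from `x` to `y` for every simple `s` with `y = s⁻¹ * x * s`. -/
def SSSArrow (S : Set G) (Δ b x s y : G) : Prop :=
  x ∈ SSS S Δ b ∧ y ∈ SSS S Δ b ∧ s ∈ S ∧ y = s⁻¹ * x * s

/-- The number of rows of the toroidal grid, `l * lcm(|p|, r) / |p|` for `p ≠ 0` and `l` for
`p = 0`, where `p = inf b`, `l = cl b` and `r = ord b`. -/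
noncomputable def rows (S : Set G) (Δ b : G) : ℕ :=
  if infimum S Δ b = 0 then cl S Δ b
  else cl S Δ b * (Nat.lcm (infimum S Δ b).natAbs (ord Δ b) / (infimum S Δ b).natAbs)

end Groups

end Garside

namespace Garside

/-! ### Divisibility, complements, gcds and lcms in the ambient group. -/

section Basic

variable {G : Type*} [Group G] {S : Set G} {Δ : G}

/-! Rigidity says that the normal form of `b` can be continued periodically: repeating its factors,
twisted by `τ ^ (-p)` on each lap, gives a bi-infinite sequence `σ` of proper simple elements with
consecutive terms left weighted (`RigidSeq`). Cycling moves a window of length `l` along `σ`, so all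
iterated cyclings and decyclings have explicit normal forms, and advancing one full lap is `τ ^
(-p)`. For `l ≥ 2` rigidity is automatic: if the last factor and the twisted first factor were not
left weighted, the spindle condition would make their product simple or divisible by `Δ`, and
cycling would lower `sup` or raise `inf`.

The core is `label_cases`. A simple `s` is compared with `∂ z`, where `z` is the last factor of the
window. In a spindle system the two are coprime or one divides the other. In each case the normal
form of the conjugate can be controlled, and staying between `Δ ^ p` and `Δ ^ (p + l)` leaves only
`1`, `Δ`, the next term of `σ`, and `∂ z`. This rests on `comparable`: left divisors of a simple
element other than `Δ` form a chain.

All four conjugations stay in the family `τ ^ j (c ^ i b)`. Super summit sets are connected under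
simple conjugations (`conj_mem_of_simple_conj_mem`), so this family is all of `SSS b`. The torus and
the bound `l * r` then follow from the lap relation and the finite order of `τ` on `b`. -/

theorem leftLE_iff {a b : G} : LeftLE S a b ↔ a⁻¹ * b ∈ posMonoid S := by
  constructor
  · rintro ⟨c, hc, rfl⟩
    simpa using hc
  · exact fun h => ⟨_, h, by group⟩

theorem LeftLE.refl (a : G) : LeftLE S a a := ⟨1, one_mem _, by simp⟩

theorem LeftLE.trans {a b c : G} (h₁ : LeftLE S a b) (h₂ : LeftLE S b c) : LeftLE S a c := by
  obtain ⟨u, hu, rfl⟩ := h₁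
  obtain ⟨v, hv, rfl⟩ := h₂
  exact ⟨u * v, mul_mem hu hv, by group⟩

theorem leftLE_mul_iff (c : G) {a b : G} : LeftLE S (c * a) (c * b) ↔ LeftLE S a b := by
  rw [leftLE_iff, leftLE_iff]
  group

theorem leftLE_mul_right {a c : G} (hc : c ∈ posMonoid S) : LeftLE S a (a * c) := ⟨c, hc, rfl⟩

theorem one_leftLE {a : G} : LeftLE S 1 a ↔ a ∈ posMonoid S := by simp [leftLE_iff]

theorem mem_pos_of_leftLE {a b : G} (ha : a ∈ posMonoid S) (h : LeftLE S a b) :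
    b ∈ posMonoid S :=
  one_leftLE.1 ((one_leftLE.2 ha).trans h)

theorem tau_apply (a : G) : tau Δ a = Δ⁻¹ * a * Δ := by simp [tau]

theorem tau_zpow_apply (k : ℤ) (a : G) : (tau Δ ^ k) a = Δ ^ (-k) * a * Δ ^ k := by
  rw [tau, ← map_zpow, MulAut.conj_apply, inv_zpow', zpow_neg, inv_inv]

theorem mul_delta_zpow (a : G) (k : ℤ) : a * Δ ^ k = Δ ^ k * (tau Δ ^ k) a := by
  rw [tau_zpow_apply]
  group

theorem tau_zpow_delta_zpow (j k : ℤ) : (tau Δ ^ j) (Δ ^ k) = Δ ^ k := by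
  rw [tau_zpow_apply]
  group

theorem tau_zpow_tau_zpow (j k : ℤ) (a : G) :
    (tau Δ ^ j) ((tau Δ ^ k) a) = (tau Δ ^ (j + k)) a := by
  rw [zpow_add]
  rfl

theorem tau_zpow_compl (k : ℤ) (a : G) :
    (tau Δ ^ k) (compl Δ a) = compl Δ ((tau Δ ^ k) a) := by
  rw [compl, compl, map_mul, map_inv]
  congr 1
  simpa using tau_zpow_delta_zpow (Δ := Δ) k 1

theorem compl_compl (a : G) : compl Δ (compl Δ a) = tau Δ a := by
  rw [tau_apply, compl, compl]
  group

theorem mul_compl (a : G) : a * compl Δ a = Δ := by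
  rw [compl]
  group

/-- `a` and `b` have no nontrivial common left divisor in `G⁺`. -/
def LeftCoprime (S : Set G) (a b : G) : Prop :=
  ∀ e ∈ posMonoid S, LeftLE S e a → LeftLE S e b → e = 1

theorem LeftCoprime.mono {a a' b b' : G} (h : LeftCoprime S a b) (ha : LeftLE S a' a)
    (hb : LeftLE S b' b) : LeftCoprime S a' b' :=
  fun e he h₁ h₂ => h e he (h₁.trans ha) (h₂.trans hb)

namespace IsGarsideSystem

theorem subset_pos {s : G} (hs : s ∈ S) : s ∈ posMonoid S := Submonoid.subset_closure hs

variable (hG : IsGarsideSystem S Δ)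
include hG

theorem mem_iff_leftLE {s : G} : s ∈ S ↔ s ∈ posMonoid S ∧ LeftLE S s Δ := by
  have h := hG.eq_leftDivisors
  exact Set.ext_iff.1 h s

theorem mem_iff_rightLE {s : G} : s ∈ S ↔ s ∈ posMonoid S ∧ RightLE S s Δ := by
  have h := hG.eq_rightDivisors
  exact Set.ext_iff.1 h s

theorem leftLE_delta {s : G} (hs : s ∈ S) : LeftLE S s Δ := (hG.mem_iff_leftLE.1 hs).2

theorem one_mem : (1 : G) ∈ S :=
  hG.mem_iff_leftLE.2 ⟨Submonoid.one_mem _, one_leftLE.2 hG.delta_mem⟩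

theorem delta_mem_simples : Δ ∈ S := hG.mem_iff_leftLE.2 ⟨hG.delta_mem, LeftLE.refl _⟩

theorem mem_of_leftLE {s t : G} (ht : t ∈ S) (hs : s ∈ posMonoid S) (h : LeftLE S s t) : s ∈ S :=
  hG.mem_iff_leftLE.2 ⟨hs, h.trans (hG.leftLE_delta ht)⟩

theorem mem_of_rightLE {s t : G} (ht : t ∈ S) (hs : s ∈ posMonoid S) (h : RightLE S s t) :
    s ∈ S := by
  obtain ⟨c, hc, hΔ⟩ := (hG.mem_iff_rightLE.1 ht).2
  obtain ⟨d, hd, rfl⟩ := h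
  exact hG.mem_iff_rightLE.2 ⟨hs, c * d, mul_mem hc hd, by rw [hΔ]; group⟩

theorem compl_mem {s : G} (hs : s ∈ S) : compl Δ s ∈ S := by
  have h : compl Δ s ∈ posMonoid S := leftLE_iff.1 (hG.leftLE_delta hs)
  exact hG.mem_iff_rightLE.2 ⟨h, s, subset_pos hs, (mul_compl s).symm⟩

theorem tau_mem {s : G} (hs : s ∈ S) : tau Δ s ∈ S := by
  rw [← compl_compl]
  exact hG.compl_mem (hG.compl_mem hs)

/-- Balancedness is used twice: if `Δ = c * s`, then `c` is simple, hence also a right divisor, `Δ =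
d * c`, and `τ d = s`. -/
theorem tau_inv_mem {s : G} (hs : s ∈ S) : (tau Δ)⁻¹ s ∈ S := by
  obtain ⟨c, hc, hΔ⟩ := (hG.mem_iff_rightLE.1 hs).2
  obtain ⟨d, hd, hΔ'⟩ :=
    (hG.mem_iff_rightLE.1 (hG.mem_iff_leftLE.2 ⟨hc, s, subset_pos hs, hΔ⟩)).2
  have h : (tau Δ)⁻¹ s = d := by
    rw [MulAut.inv_apply, MulEquiv.symm_apply_eq, tau_apply]
    rw [show Δ⁻¹ * d * Δ = (c⁻¹ * d⁻¹) * d * (c * s) by rw [← mul_inv_rev, ← hΔ', ← hΔ]]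
    group
  rw [h]
  exact hG.mem_iff_leftLE.2 ⟨hd, c, hc, hΔ'⟩

theorem tau_zpow_mem (k : ℤ) {s : G} (hs : s ∈ S) : (tau Δ ^ k) s ∈ S := by
  induction k with
  | zero => simpa using hs
  | succ n ih =>
    rw [add_comm, zpow_add, zpow_one]
    exact hG.tau_mem ih
  | pred n ih =>
    rw [sub_eq_add_neg, add_comm, zpow_add, zpow_neg_one]
    exact hG.tau_inv_mem ih

theorem tau_zpow_mem_pos (k : ℤ) {a : G} (ha : a ∈ posMonoid S) :
    (tau Δ ^ k) a ∈ posMonoid S := by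
  induction ha using Submonoid.closure_induction with
  | mem x hx => exact subset_pos (hG.tau_zpow_mem k hx)
  | one => simp
  | mul x y _ _ hx hy => simpa using mul_mem hx hy

theorem tau_zpow_leftLE_iff (k : ℤ) {a b : G} :
    LeftLE S ((tau Δ ^ k) a) ((tau Δ ^ k) b) ↔ LeftLE S a b := by
  rw [leftLE_iff, leftLE_iff, ← map_inv, ← map_mul]
  refine ⟨fun h => ?_, hG.tau_zpow_mem_pos k⟩
  have := hG.tau_zpow_mem_pos (-k) h
  rwa [tau_zpow_tau_zpow, neg_add_cancel, zpow_zero] at this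

/-- The order is invariant under left translations only; powers of `Δ` may also be cancelled on the
right because `τ` preserves `G⁺`. -/
theorem mul_delta_zpow_leftLE_iff (k : ℤ) {a b : G} :
    LeftLE S (a * Δ ^ k) (b * Δ ^ k) ↔ LeftLE S a b := by
  rw [mul_delta_zpow, mul_delta_zpow, leftLE_mul_iff, hG.tau_zpow_leftLE_iff]

theorem tau_zpow_coprime (k : ℤ) {a b : G} (h : LeftCoprime S a b) :
    LeftCoprime S ((tau Δ ^ k) a) ((tau Δ ^ k) b) := by
  intro e he h₁ h₂
  have key : e = (tau Δ ^ k) ((tau Δ ^ (-k)) e) := by simp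
  rw [key, hG.tau_zpow_leftLE_iff] at h₁ h₂
  rw [key, h _ (hG.tau_zpow_mem_pos _ he) h₁ h₂, map_one]

/-- The Noetherian condition, phrased in the ambient group. -/
theorem exists_length_bound {g : G} (hg : g ∈ posMonoid S) :
    ∃ n : ℕ, ∀ L : List G, (∀ x ∈ L, x ∈ posMonoid S ∧ x ≠ 1) → L.prod = g → L.length ≤ n := by
  obtain ⟨n, hn⟩ := hG.lcmMonoid.noetherian ⟨g, hg⟩
  refine ⟨n, fun L hL hp => ?_⟩
  lift L to List (posMonoid S) using fun x hx => (hL x hx).1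
  rw [List.length_map]
  refine hn L (fun x hx h1 => ?_) ?_
  · exact (hL x (List.mem_map_of_mem hx)).2 (by rw [h1]; rfl)
  · exact Subtype.ext ((Submonoid.coe_list_prod _ L).trans hp)

/-- Otherwise the words `a b a b ⋯` would be arbitrarily long factorizations of `1`. -/
theorem eq_one_of_mul_eq_one {a b : G} (ha : a ∈ posMonoid S) (hb : b ∈ posMonoid S)
    (h : a * b = 1) : a = 1 := by
  by_contra h1
  have hb1 : b ≠ 1 := by
    rintro rfl
    exact h1 (by simpa using h)
  obtain ⟨n, hn⟩ := hG.exists_length_bound (Submonoid.one_mem (posMonoid S))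
  have := hn ((List.replicate (n + 1) [a, b]).flatten) (by
    intro x hx
    simp only [List.mem_flatten, List.mem_replicate] at hx
    obtain ⟨l, ⟨-, rfl⟩, hx⟩ := hx
    simp only [List.mem_cons, List.not_mem_nil, or_false] at hx
    rcases hx with rfl | rfl
    exacts [⟨ha, h1⟩, ⟨hb, hb1⟩]) (by simp [List.prod_flatten, h])
  simp at this
  omega

theorem leftLE_antisymm {a b : G} (h₁ : LeftLE S a b) (h₂ : LeftLE S b a) : a = b := by
  obtain ⟨c, hc, rfl⟩ := h₁
  obtain ⟨d, hd, h⟩ := h₂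
  have : c = 1 := hG.eq_one_of_mul_eq_one hc hd
    (mul_left_cancel (a := a) (by rw [← mul_assoc, ← h, mul_one]))
  simp [this]

theorem eq_one_of_leftLE_one {a : G} (ha : a ∈ posMonoid S) (h : LeftLE S a 1) : a = 1 :=
  hG.leftLE_antisymm h (one_leftLE.2 ha)

theorem exists_lcm {a b : G} (ha : a ∈ posMonoid S) (hb : b ∈ posMonoid S) :
    ∃ m, LeftLE S a m ∧ LeftLE S b m ∧
      ∀ c ∈ posMonoid S, LeftLE S a c → LeftLE S b c → LeftLE S m c := by
  obtain ⟨m, ⟨x, hx⟩, ⟨y, hy⟩, h⟩ := hG.lcmMonoid.right_lcm ⟨a, ha⟩ ⟨b, hb⟩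
  refine ⟨m, ⟨x, x.2, by rw [hx]; rfl⟩, ⟨y, y.2, by rw [hy]; rfl⟩, ?_⟩
  rintro c hc ⟨u, hu, hcu⟩ ⟨v, hv, hcv⟩
  obtain ⟨w, hw⟩ := h ⟨c, hc⟩ ⟨⟨u, hu⟩, Subtype.ext hcu⟩ ⟨⟨v, hv⟩, Subtype.ext hcv⟩
  exact ⟨w, w.2, congrArg Subtype.val hw⟩

theorem exists_leftLE_delta_pow {a : G} (ha : a ∈ posMonoid S) : ∃ n : ℕ, LeftLE S a (Δ ^ n) := by
  induction ha using Submonoid.closure_induction with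
  | mem x hx => exact ⟨1, by simpa using hG.leftLE_delta hx⟩
  | one => exact ⟨0, by simpa using LeftLE.refl _⟩
  | mul x y _ _ hx hy =>
    obtain ⟨m, hm⟩ := hx
    obtain ⟨n, hn⟩ := hy
    refine ⟨m + n, ((leftLE_mul_iff x).2 hn).trans ?_⟩
    rw [pow_add]
    simpa using (hG.mul_delta_zpow_leftLE_iff (n : ℤ)).2 hm

/-- Every element of the group is `Δ ^ k` times a positive element. -/
theorem exists_delta_zpow_leftLE (g : G) : ∃ k : ℤ, LeftLE S (Δ ^ k) g := by
  obtain ⟨a, ha, b, hb, rfl⟩ := hG.right_fractions g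
  obtain ⟨n, c, hc, hn⟩ := hG.exists_leftLE_delta_pow hb
  refine ⟨-n, ?_⟩
  have h : a * b⁻¹ = Δ ^ (-(n : ℤ)) * (tau Δ ^ (-(n : ℤ))) (a * c) := by
    rw [← mul_delta_zpow, zpow_neg, zpow_natCast, hn]
    group
  rw [h]
  exact leftLE_mul_right (hG.tau_zpow_mem_pos _ (mul_mem ha hc))

/-- The positive part `a ∨ 1` of an element of the group. -/
theorem exists_lcm_one (a : G) :
    ∃ m ∈ posMonoid S, LeftLE S a m ∧ ∀ c ∈ posMonoid S, LeftLE S a c → LeftLE S m c := by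
  obtain ⟨k, h, hh, rfl⟩ := hG.exists_delta_zpow_leftLE a
  -- Translating by `Δ ^ n` makes both `a` and `1` positive; the lcm taken there is translated back.
  obtain ⟨n, hn⟩ : ∃ n : ℕ, k + n = k.toNat := ⟨(-k).toNat, by omega⟩
  have hpos (i : ℕ) : Δ ^ i ∈ posMonoid S := pow_mem hG.delta_mem i
  obtain ⟨m, hm₁, hm₂, hm⟩ := hG.exists_lcm (mul_mem (hpos k.toNat) hh) (hpos n)
  have e : Δ ^ (n : ℤ) * (Δ ^ k * h) = Δ ^ k.toNat * h := by
    rw [← zpow_natCast Δ k.toNat, ← hn, ← mul_assoc, ← zpow_add, add_comm]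
  refine ⟨Δ ^ (-n : ℤ) * m, ?_, ?_, fun c hc hac => ?_⟩
  · rw [← one_leftLE, ← leftLE_mul_iff (Δ ^ (n : ℤ))]
    simpa using hm₂
  · rw [← leftLE_mul_iff (Δ ^ (n : ℤ)), e]
    simpa using hm₁
  · rw [← leftLE_mul_iff (Δ ^ (n : ℤ))] at hac ⊢
    rw [e] at hac
    simpa using hm (Δ ^ (n : ℤ) * c) (by simpa using mul_mem (hpos n) hc) hac
      (by simpa using leftLE_mul_right hc)

/-- A left gcd of positive elements is a greatest lower bound in the whole group. -/
theorem leftLE_of_isLeftGcd {a b d e : G} (ha : a ∈ posMonoid S) (hb : b ∈ posMonoid S)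
    (h : IsLeftGcd S a b d) (h₁ : LeftLE S e a) (h₂ : LeftLE S e b) : LeftLE S e d := by
  obtain ⟨m, hm, hem, hm'⟩ := hG.exists_lcm_one e
  exact hem.trans (h.2.2.2 m hm (hm' a ha h₁) (hm' b hb h₂))

theorem isLeftGcd_unique {a b d d' : G} (h : IsLeftGcd S a b d) (h' : IsLeftGcd S a b d') :
    d = d' :=
  hG.leftLE_antisymm (h'.2.2.2 d h.1 h.2.1 h.2.2.1) (h.2.2.2 d' h'.1 h'.2.1 h'.2.2.1)

/-- The simple left divisors of `g` are finite in number, and the lcm of two of them still divides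
both `Δ` and `g`; their common lcm is the gcd. -/
theorem exists_gcd_delta {g : G} (hg : g ∈ posMonoid S) : ∃ s ∈ S, IsLeftGcd S Δ g s := by
  have key (T : Set G) (hT : T.Finite) : T ⊆ {s | s ∈ S ∧ LeftLE S s g} →
      ∃ m, (m ∈ S ∧ LeftLE S m g) ∧ ∀ t ∈ T, LeftLE S t m := by
    induction T, hT using Set.Finite.induction_on with
    | empty => exact fun _ => ⟨1, ⟨hG.one_mem, one_leftLE.2 hg⟩, by simp⟩
    | insert _ _ ih =>
      intro hsub
      obtain ⟨ha, hT⟩ := Set.insert_subset_iff.1 hsub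
      obtain ⟨m, ⟨hm, hmg⟩, hle⟩ := ih hT
      obtain ⟨c, h₁, h₂, h₃⟩ := hG.exists_lcm (subset_pos ha.1) (subset_pos hm)
      refine ⟨c, ⟨hG.mem_iff_leftLE.2 ⟨mem_pos_of_leftLE (subset_pos hm) h₂,
        h₃ Δ hG.delta_mem (hG.leftLE_delta ha.1) (hG.leftLE_delta hm)⟩, h₃ g hg ha.2 hmg⟩, ?_⟩
      rintro t (rfl | ht)
      exacts [h₁, (hle t ht).trans h₂]
  obtain ⟨m, ⟨hm, hmg⟩, hle⟩ := key _ (hG.finite.subset fun _ h => h.1) subset_rfl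
  exact ⟨m, hm, subset_pos hm, hG.leftLE_delta hm, hmg,
    fun e he h₁ h₂ => hle e ⟨hG.mem_iff_leftLE.2 ⟨he, h₁⟩, h₂⟩⟩

end IsGarsideSystem

end Basic

end Garside

namespace Garside

/-! ### Left normal forms, `inf` and `sup`, and their behaviour in spindle systems. -/

section NormalForm

variable {G : Type*} [Group G] {S : Set G} {Δ : G}

/-- The product of the simple elements `s` and `t` is left weighted: `∂ s ∧ t = 1`. -/
def LeftWeighted (S : Set G) (Δ s t : G) : Prop := LeftCoprime S (compl Δ s) t

theorem list_prod_mem_pos {L : List G} (h : ∀ s ∈ L, s ∈ S) : L.prod ∈ posMonoid S :=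
  list_prod_mem fun s hs => IsGarsideSystem.subset_pos (h s hs)

theorem IsLeftNormal.mem {L : List G} (h : IsLeftNormal S Δ L) : ∀ s ∈ L, s ∈ S ∧ s ≠ 1 := by
  induction L with
  | nil => simp
  | cons a L ih =>
    intro s hs
    rcases List.mem_cons.1 hs with rfl | hs
    exacts [⟨h.1, h.2.1⟩, ih h.2.2.2 s hs]

namespace IsGarsideSystem

variable (hG : IsGarsideSystem S Δ)
include hG

theorem leftWeighted_of_isLeftGcd {s t g : G} (hg : g ∈ posMonoid S)
    (h : IsLeftGcd S Δ (s * (t * g)) s) : LeftWeighted S Δ s t := by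
  intro e he h₁ h₂
  have h₃ := h.2.2.2 (s * e) (mul_mem h.1 he)
    (by simpa [mul_compl] using (leftLE_mul_iff s).2 h₁)
    ((leftLE_mul_iff s).2 (h₂.trans (leftLE_mul_right hg)))
  refine hG.eq_one_of_leftLE_one he ?_
  rwa [← leftLE_mul_iff s, mul_one]

/-- If `e` divides `Δ` and `s * g`, write the lcm of `e` and `s` as `s * u`. Then `u` divides `∂ s`
and `g`, so it divides `t = Δ ∧ g`, and weightedness forces `u = 1`. -/
theorem isLeftGcd_of_leftWeighted {s t g : G} (hs : s ∈ S) (h : LeftWeighted S Δ s t)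
    (ht : IsLeftGcd S Δ g t) (hg : g ∈ posMonoid S) : IsLeftGcd S Δ (s * g) s := by
  have hs' := subset_pos hs
  refine ⟨hs', hG.leftLE_delta hs, leftLE_mul_right hg, fun e he h₁ h₂ => ?_⟩
  obtain ⟨m, hem, ⟨u, hu, rfl⟩, hm⟩ := hG.exists_lcm he hs'
  have hΔ := hm Δ hG.delta_mem h₁ (hG.leftLE_delta hs)
  have hsg := (leftLE_mul_iff s).1 (hm _ (mul_mem hs' hg) h₂ (leftLE_mul_right hg))
  have huc : LeftLE S u (compl Δ s) := by rwa [← leftLE_mul_iff s, mul_compl]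
  have hut := ht.2.2.2 u hu (huc.trans (hG.leftLE_delta (hG.compl_mem hs))) hsg
  rw [h u hu huc hut, mul_one] at hem
  exact hem

theorem isLeftGcd_delta_self {s : G} (hs : s ∈ S) : IsLeftGcd S Δ s s :=
  ⟨subset_pos hs, hG.leftLE_delta hs, LeftLE.refl _, fun _ _ _ h => h⟩

/-- A list of nontrivial simple elements is a left normal form iff consecutive factors are
left weighted. -/
theorem isLeftNormal_iff {L : List G} :
    IsLeftNormal S Δ L ↔ (∀ s ∈ L, s ∈ S ∧ s ≠ 1) ∧ L.IsChain (LeftWeighted S Δ) := by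
  refine ⟨fun h => ⟨h.mem, ?_⟩, fun ⟨hm, hc⟩ => ?_⟩
  · induction L with
    | nil => exact .nil
    | cons s L ih =>
      cases L with
      | nil => exact .singleton _
      | cons t L =>
        refine List.isChain_cons_cons.2 ⟨?_, ih h.2.2.2⟩
        exact hG.leftWeighted_of_isLeftGcd
          (list_prod_mem_pos fun x hx => (h.2.2.2.2.2.2.mem x hx).1)
          (by simpa using h.2.2.1)
  · induction L with
    | nil => trivial
    | cons s L ih =>
      obtain ⟨hs, hL⟩ := List.forall_mem_cons.1 hm
      have hN := ih ⟨hL, hc.tail⟩ hL hc.tail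
      refine ⟨hs.1, hs.2, ?_, hN⟩
      cases L with
      | nil => simpa using hG.isLeftGcd_delta_self hs.1
      | cons t L =>
        refine hG.isLeftGcd_of_leftWeighted hs.1 (List.isChain_cons_cons.1 hc).1 ?_
          (list_prod_mem_pos fun x hx => (hL x hx).1)
        simpa using hN.2.2.1

theorem isLeftNormal_unique {L L' : List G} (h : IsLeftNormal S Δ L) (h' : IsLeftNormal S Δ L')
    (he : L.prod = L'.prod) : L = L' := by
  have aux {s : G} {L : List G} (h : IsLeftNormal S Δ (s :: L)) : (1 : G) ≠ (s :: L).prod := by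
    intro he
    rw [List.prod_cons] at he
    exact h.2.1 (hG.eq_one_of_mul_eq_one (subset_pos h.1)
      (list_prod_mem_pos fun x hx => (h.2.2.2.mem x hx).1) he.symm)
  induction L generalizing L' with
  | nil =>
    cases L' with
    | nil => rfl
    | cons s L => exact absurd he (aux h')
  | cons s L ih =>
    cases L' with
    | nil => exact absurd he.symm (aux h)
    | cons s' L' =>
      rw [List.prod_cons, List.prod_cons] at he
      obtain rfl : s = s' := hG.isLeftGcd_unique h.2.2.1 (he ▸ h'.2.2.1)
      rw [ih h.2.2.2 h'.2.2.2 (mul_left_cancel he)]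

theorem prod_leftLE_delta_pow {L : List G} (h : ∀ s ∈ L, s ∈ S) :
    LeftLE S L.prod (Δ ^ L.length) := by
  induction L with
  | nil => simpa using LeftLE.refl 1
  | cons s L ih =>
    obtain ⟨hs, hL⟩ := List.forall_mem_cons.1 h
    rw [List.prod_cons, List.length_cons, pow_succ']
    refine ((leftLE_mul_iff s).2 (ih hL)).trans ?_
    simpa using (hG.mul_delta_zpow_leftLE_iff (L.length : ℤ)).2 (hG.leftLE_delta hs)

/-- If `s * L.prod ≼ Δ ^ (k + 1)`, then `s * L.prod * Δ ^ (-k)` lies below `Δ` and below `s *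
L.prod`, hence below their gcd `s`. This element need not be positive, so the gcd must be a greatest
lower bound in all of `G`. -/
theorem length_le_of_prod_leftLE {L : List G} (h : IsLeftNormal S Δ L) {k : ℕ}
    (hk : LeftLE S L.prod (Δ ^ k)) : L.length ≤ k := by
  induction L generalizing k with
  | nil => simp
  | cons s L ih =>
    have hL : L.prod ∈ posMonoid S := list_prod_mem_pos fun x hx => (h.2.2.2.mem x hx).1
    have hsL : s * L.prod ∈ posMonoid S := mul_mem h.2.2.1.1 hL
    rw [List.prod_cons] at hk
    rw [List.length_cons]
    cases k with
    | zero =>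
      rw [pow_zero] at hk
      exact absurd (hG.eq_one_of_mul_eq_one h.2.2.1.1 hL (hG.eq_one_of_leftLE_one hsL hk)) h.2.1
    | succ k =>
      refine Nat.succ_le_succ (ih h.2.2.2 ?_)
      have hΔk : Δ ^ k ∈ posMonoid S := pow_mem hG.delta_mem k
      have h₁ : LeftLE S (s * L.prod * Δ ^ (-k : ℤ)) Δ := by
        rw [← hG.mul_delta_zpow_leftLE_iff k]
        simpa [pow_succ'] using hk
      have h₂ : LeftLE S (s * L.prod * Δ ^ (-k : ℤ)) (s * L.prod) := by
        rw [← hG.mul_delta_zpow_leftLE_iff k]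
        simpa using leftLE_mul_right hΔk
      have h₃ := hG.leftLE_of_isLeftGcd hG.delta_mem hsL h.2.2.1 h₁ h₂
      rw [← hG.mul_delta_zpow_leftLE_iff k] at h₃
      rw [← leftLE_mul_iff s]
      simpa using h₃

theorem delta_zpow_mem_pos (hΔ : Δ ≠ 1) {k : ℤ} : Δ ^ k ∈ posMonoid S ↔ 0 ≤ k := by
  constructor
  · intro h
    by_contra! hk
    obtain ⟨n, rfl⟩ : ∃ n : ℕ, k = -(n + 1 : ℤ) := ⟨(-k - 1).toNat, by omega⟩
    refine hΔ (hG.eq_one_of_mul_eq_one hG.delta_mem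
      (mul_mem (pow_mem hG.delta_mem n) h) ?_)
    rw [← mul_assoc, ← pow_succ', ← zpow_natCast, ← zpow_add]
    simp
  · intro h
    lift k to ℕ using h
    simpa using pow_mem hG.delta_mem k

theorem delta_zpow_leftLE_delta_zpow (hΔ : Δ ≠ 1) {j k : ℤ} :
    LeftLE S (Δ ^ j) (Δ ^ k) ↔ j ≤ k := by
  rw [leftLE_iff, ← zpow_neg, ← zpow_add, hG.delta_zpow_mem_pos hΔ]
  omega

theorem exists_leftLE_delta_zpow (g : G) : ∃ k : ℤ, LeftLE S g (Δ ^ k) := by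
  obtain ⟨k, h, hh, rfl⟩ := hG.exists_delta_zpow_leftLE g
  obtain ⟨n, hn⟩ := hG.exists_leftLE_delta_pow hh
  refine ⟨k + n, ?_⟩
  rw [zpow_add, leftLE_mul_iff]
  simpa using hn

theorem delta_zpow_leftLE_of_le {j k : ℤ} (h : j ≤ k) : LeftLE S (Δ ^ j) (Δ ^ k) := by
  obtain ⟨n, rfl⟩ := Int.le.dest h
  rw [zpow_add]
  exact leftLE_mul_right (by simpa using pow_mem hG.delta_mem n)

theorem delta_zpow_leftLE_iff (hΔ : Δ ≠ 1) {g : G} {k : ℤ} :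
    LeftLE S (Δ ^ k) g ↔ k ≤ infimum S Δ g := by
  have hne : {k : ℤ | LeftLE S (Δ ^ k) g}.Nonempty := hG.exists_delta_zpow_leftLE g
  have hbdd : BddAbove {k : ℤ | LeftLE S (Δ ^ k) g} := by
    obtain ⟨q, hq⟩ := hG.exists_leftLE_delta_zpow g
    exact ⟨q, fun k hk => (hG.delta_zpow_leftLE_delta_zpow hΔ).1 (LeftLE.trans hk hq)⟩
  refine ⟨fun h => le_csSup hbdd h, fun h => ?_⟩
  exact (hG.delta_zpow_leftLE_of_le h).trans (Int.csSup_mem hne hbdd)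

theorem leftLE_delta_zpow_iff (hΔ : Δ ≠ 1) {g : G} {k : ℤ} :
    LeftLE S g (Δ ^ k) ↔ supremum S Δ g ≤ k := by
  have hne : {k : ℤ | LeftLE S g (Δ ^ k)}.Nonempty := hG.exists_leftLE_delta_zpow g
  have hbdd : BddBelow {k : ℤ | LeftLE S g (Δ ^ k)} := by
    obtain ⟨q, hq⟩ := hG.exists_delta_zpow_leftLE g
    exact ⟨q, fun k hk => (hG.delta_zpow_leftLE_delta_zpow hΔ).1 (hq.trans hk)⟩
  refine ⟨fun h => csInf_le hbdd h, fun h => ?_⟩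
  exact LeftLE.trans (Int.csInf_mem hne hbdd) (hG.delta_zpow_leftLE_of_le h)

theorem leftLE_delta_zpow_iff_of_normal (hΔ : Δ ≠ 1) {L : List G} (h : IsLeftNormal S Δ L)
    {p k : ℤ} : LeftLE S (Δ ^ p * L.prod) (Δ ^ k) ↔ p + L.length ≤ k := by
  have e : Δ ^ k = Δ ^ p * Δ ^ (k - p) := by rw [← zpow_add, add_sub_cancel]
  rw [e, leftLE_mul_iff]
  constructor
  · intro hk
    have hL : L.prod ∈ posMonoid S := list_prod_mem_pos fun x hx => (h.mem x hx).1
    have h0 := (hG.delta_zpow_mem_pos hΔ).1 (mem_pos_of_leftLE hL hk)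
    obtain ⟨n, hn⟩ := Int.eq_ofNat_of_zero_le h0
    rw [hn, zpow_natCast] at hk
    have := hG.length_le_of_prod_leftLE h hk
    omega
  · intro hk
    refine (hG.prod_leftLE_delta_pow fun x hx => (h.mem x hx).1).trans ?_
    rw [← zpow_natCast]
    exact hG.delta_zpow_leftLE_of_le (by omega)

theorem supremum_eq (hΔ : Δ ≠ 1) {L : List G} (h : IsLeftNormal S Δ L) (p : ℤ) :
    supremum S Δ (Δ ^ p * L.prod) = p + L.length :=
  eq_of_forall_ge_iff fun k => by
    rw [← hG.leftLE_delta_zpow_iff hΔ, hG.leftLE_delta_zpow_iff_of_normal hΔ h]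

theorem delta_zpow_leftLE_iff_of_normal (hΔ : Δ ≠ 1) {L : List G} (h : IsLeftNormal S Δ L)
    (hL : Δ ∉ L) {p k : ℤ} : LeftLE S (Δ ^ k) (Δ ^ p * L.prod) ↔ k ≤ p := by
  have hLp : L.prod ∈ posMonoid S := list_prod_mem_pos fun x hx => (h.mem x hx).1
  constructor
  · intro hk
    by_contra! hlt
    have hk := (hG.delta_zpow_leftLE_of_le (Int.add_one_le_iff.2 hlt)).trans hk
    rw [zpow_add, leftLE_mul_iff, zpow_one] at hk
    cases L with
    | nil =>
      rw [List.prod_nil] at hk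
      exact hΔ (hG.eq_one_of_leftLE_one hG.delta_mem hk)
    | cons s L =>
      have := h.2.2.1.2.2.2 Δ hG.delta_mem (LeftLE.refl _) (by simpa using hk)
      exact hL (hG.leftLE_antisymm (hG.leftLE_delta h.1) this ▸ List.mem_cons_self)
  · intro hk
    exact (hG.delta_zpow_leftLE_of_le hk).trans (leftLE_mul_right hLp)

theorem infimum_eq (hΔ : Δ ≠ 1) {L : List G} (h : IsLeftNormal S Δ L) (hL : Δ ∉ L) (p : ℤ) :
    infimum S Δ (Δ ^ p * L.prod) = p :=
  eq_of_forall_le_iff fun k => by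
    rw [← hG.delta_zpow_leftLE_iff hΔ, hG.delta_zpow_leftLE_iff_of_normal hΔ h hL]

theorem factors_eq (hΔ : Δ ≠ 1) {L : List G} (h : IsLeftNormal S Δ L) (hL : Δ ∉ L) (p : ℤ) :
    factors S Δ (Δ ^ p * L.prod) = L := by
  have hex : ∃ L', IsLeftNormal S Δ L' ∧
      Δ ^ p * L.prod = Δ ^ infimum S Δ (Δ ^ p * L.prod) * L'.prod :=
    ⟨L, h, by rw [hG.infimum_eq hΔ h hL]⟩
  rw [factors, dif_pos hex]
  obtain ⟨h₁, h₂⟩ := hex.choose_spec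
  have h₃ := h₂.trans (congrArg (fun k => Δ ^ k * hex.choose.prod) (hG.infimum_eq hΔ h hL p))
  exact (hG.isLeftNormal_unique h h₁ (mul_left_cancel h₃)).symm

end IsGarsideSystem

namespace IsSpindle

variable (hG : IsSpindle S Δ)
include hG

theorem comparable_or_coprime {a b : G} (ha : a ∈ S) (hb : b ∈ S) :
    LeftLE S a b ∨ LeftLE S b a ∨ LeftCoprime S a b := by
  obtain ⟨d, hd, rfl | rfl | rfl⟩ := hG.left_gcd a ha b hb
  · exact .inl hd.2.2.1
  · exact .inr (.inl hd.2.1)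
  · exact .inr (.inr fun e he h₁ h₂ => hG.eq_one_of_leftLE_one he (hd.2.2.2 e he h₁ h₂))

/-- Two left divisors of a simple element other than `Δ` are comparable. -/
theorem comparable {a b c : G} (ha : a ∈ posMonoid S) (hb : b ∈ posMonoid S) (hc : c ∈ S)
    (hcΔ : c ≠ Δ) (hac : LeftLE S a c) (hbc : LeftLE S b c) : LeftLE S a b ∨ LeftLE S b a := by
  have haS := hG.mem_of_leftLE hc ha hac
  have hbS := hG.mem_of_leftLE hc hb hbc
  have key {x : G} (h : LeftLE S x c) : RightLE S (compl Δ c) (compl Δ x) :=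
    ⟨x⁻¹ * c, leftLE_iff.1 h, by rw [compl, compl]; group⟩
  have hcc := IsGarsideSystem.subset_pos (hG.compl_mem hc)
  -- Complements reverse divisibility, so `∂ c` is a common right divisor of `∂ a` and `∂ b`. Their
  -- right gcd is therefore nontrivial as `c ≠ Δ`, and the spindle condition makes it one of the
  -- two.
  obtain ⟨d, hd, h⟩ := hG.right_gcd _ (hG.compl_mem haS) _ (hG.compl_mem hbS)
  rcases h with rfl | rfl | rfl
  · right
    obtain ⟨w, hw, h⟩ := hd.2.2.1
    rw [compl, compl, ← mul_assoc] at h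
    exact ⟨w, hw, by rw [← inv_inj, mul_inv_rev, mul_right_cancel h]; group⟩
  · left
    obtain ⟨w, hw, h⟩ := hd.2.1
    rw [compl, compl, ← mul_assoc] at h
    exact ⟨w, hw, by rw [← inv_inj, mul_inv_rev, mul_right_cancel h]; group⟩
  · obtain ⟨w, hw, h⟩ := hd.2.2.2 _ hcc (key hac) (key hbc)
    have h1 := hG.eq_one_of_mul_eq_one hw hcc h.symm
    rw [h1, one_mul, compl, eq_comm, inv_mul_eq_one] at h
    exact absurd h hcΔ

/-- A common divisor `e` of `∂ u` and `w` is comparable with `∂ (t * u)`, since both divide `∂ u ≠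
Δ`. Either `e` divides `∂ (t * u)` and is trivial, or the nontrivial `∂ (t * u)` divides `w`, which
is excluded. -/
theorem leftWeighted_of_suffix {t u w : G} (ht : t ∈ posMonoid S) (hu : u ∈ posMonoid S)
    (htu : t * u ∈ S) (hw : w ∈ S) (htuΔ : t * u ≠ Δ) (hu1 : u ≠ 1)
    (h : LeftWeighted S Δ (t * u) w) : LeftWeighted S Δ u w := by
  have huS : u ∈ S := hG.mem_of_rightLE htu hu ⟨t, ht, rfl⟩
  have hle : LeftLE S (compl Δ (t * u)) (compl Δ u) := by
    refine ⟨tau Δ t, ?_, ?_⟩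
    · simpa using hG.tau_zpow_mem_pos 1 ht
    · rw [compl, compl, tau_apply]
      group
  have hne : compl Δ (t * u) ≠ 1 := by
    rw [compl, Ne, inv_mul_eq_one]
    exact htuΔ
  have hcS := hG.compl_mem htu
  have hcΔ : compl Δ u ≠ Δ := by
    rw [compl, Ne, mul_eq_right, inv_eq_one]
    exact hu1
  have hwp := IsGarsideSystem.subset_pos hw
  have hcp := IsGarsideSystem.subset_pos hcS
  intro e he h₁ h₂
  rcases hG.comparable he hcp (hG.compl_mem huS) hcΔ h₁ hle with h₃ | h₃
  · exact h e he h₃ h₂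
  · exact absurd (h _ hcp (LeftLE.refl _) (h₃.trans h₂)) hne

/-- A divisor of `a` is comparable with the nontrivial prefix `s`, so a common divisor with `∂ w` is
already seen by `s`. -/
theorem leftWeighted_of_prefix {w s a : G} (hs : s ∈ S) (ha : a ∈ S) (haΔ : a ≠ Δ)
    (hs1 : s ≠ 1) (hsa : LeftLE S s a) (h : LeftWeighted S Δ w s) : LeftWeighted S Δ w a := by
  have hsp := IsGarsideSystem.subset_pos hs
  intro e he h₁ h₂
  rcases hG.comparable he hsp ha haΔ h₂ hsa with h₃ | h₃
  · exact h e he h₁ h₃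
  · exact absurd (h s hsp (h₃.trans h₁) (LeftLE.refl _)) hs1

end IsSpindle

end NormalForm

end Garside

namespace Garside

/-! ### Windows of bi-infinite sequences. -/

section Segments

variable {α : Type*}

/-- The list `σ i, σ (i + 1), …, σ (i + n - 1)`. -/
def seg (σ : ℤ → α) (i : ℤ) : ℕ → List α
  | 0 => []
  | n + 1 => σ i :: seg σ (i + 1) n

theorem seg_succ_last (σ : ℤ → α) (i : ℤ) (n : ℕ) : seg σ i (n + 1) = seg σ i n ++ [σ (i + n)] := by
  induction n generalizing i with
  | zero => simp [seg]
  | succ n ih =>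
    rw [seg, ih, seg, List.cons_append]
    congr 4
    push_cast
    ring

theorem length_seg (σ : ℤ → α) (i : ℤ) (n : ℕ) : (seg σ i n).length = n := by
  induction n generalizing i with
  | zero => rfl
  | succ n ih => simp [seg, ih]

theorem exists_of_mem_seg {σ : ℤ → α} {i : ℤ} {n : ℕ} {x : α} (h : x ∈ seg σ i n) :
    ∃ k, x = σ k := by
  induction n generalizing i with
  | zero => simp [seg] at h
  | succ n ih =>
    rcases List.mem_cons.1 h with h | h
    exacts [⟨i, h⟩, ih h]

theorem isChain_seg_concat {R : α → α → Prop} {σ : ℤ → α} (hσ : ∀ i, R (σ i) (σ (i + 1)))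
    {i : ℤ} {n : ℕ} {y : α} (h : n ≠ 0 → R (σ (i + n - 1)) y) :
    (seg σ i n ++ [y]).IsChain R := by
  induction n generalizing i with
  | zero => exact .singleton y
  | succ n ih =>
    cases n with
    | zero => simpa [seg] using h
    | succ n =>
      have := ih (i := i + 1) fun _ => by
        have := h (Nat.succ_ne_zero _)
        convert this using 2
        push_cast
        ring
      exact List.isChain_cons_cons.2 ⟨hσ i, this⟩

theorem isChain_seg {R : α → α → Prop} {σ : ℤ → α} (hσ : ∀ i, R (σ i) (σ (i + 1)))
    (i : ℤ) (n : ℕ) : (seg σ i n).IsChain R := by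
  cases n with
  | zero => exact .nil
  | succ n =>
    rw [seg_succ_last]
    refine isChain_seg_concat hσ fun _ => ?_
    simpa using hσ (i + n - 1)

theorem seg_comp (f : α → α) (σ : ℤ → α) (i : ℤ) (n : ℕ) :
    seg (fun k => f (σ k)) i n = (seg σ i n).map f := by
  induction n generalizing i with
  | zero => rfl
  | succ n ih => simp [seg, ih]

theorem seg_shift (σ : ℤ → α) (i j : ℤ) (n : ℕ) :
    seg (fun k => σ (k + j)) i n = seg σ (i + j) n := by
  induction n generalizing i with
  | zero => rfl
  | succ n ih => simp [seg, ih, add_right_comm]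

theorem getElem_seg (σ : ℤ → α) (i : ℤ) (n k : ℕ) (hk : k < (seg σ i n).length) :
    (seg σ i n)[k] = σ (i + k) := by
  induction n generalizing i k with
  | zero => simp [seg] at hk
  | succ n ih =>
    cases k with
    | zero => simp [seg]
    | succ k =>
      simp only [seg, List.getElem_cons_succ, ih]
      congr 1
      push_cast
      ring

end Segments

/-! ### Periodic sequences of factors; cycling and decycling as shifts. -/

section RigidSeq

variable {G : Type*} [Group G] {S : Set G} {Δ : G}

/-- The factors of the iterated cyclings of a rigid element `Δ ^ p * s₁ ⋯ s_l`: a bi-infinite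
sequence of proper simple elements, consecutive ones left weighted, and periodic up to `τ ^ p`. -/
structure RigidSeq (S : Set G) (Δ : G) (p : ℤ) (l : ℕ) (σ : ℤ → G) : Prop where
  pos : 0 < l
  mem : ∀ i, σ i ∈ S
  ne_one : ∀ i, σ i ≠ 1
  ne_delta : ∀ i, σ i ≠ Δ
  weighted : ∀ i, LeftWeighted S Δ (σ i) (σ (i + 1))
  periodic : ∀ i, σ (i + l) = (tau Δ ^ (-p)) (σ i)

/-- The element `Δ ^ p * σ i ⋯ σ (i + l - 1)`. -/
def elt (Δ : G) (p : ℤ) (l : ℕ) (σ : ℤ → G) (i : ℤ) : G := Δ ^ p * (seg σ i l).prod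

theorem IsGarsideSystem.tau_zpow_leftWeighted (hG : IsGarsideSystem S Δ) (k : ℤ) {s t : G}
    (h : LeftWeighted S Δ s t) : LeftWeighted S Δ ((tau Δ ^ k) s) ((tau Δ ^ k) t) := by
  rw [LeftWeighted, ← tau_zpow_compl]
  exact hG.tau_zpow_coprime k h

namespace RigidSeq

variable {p : ℤ} {l : ℕ} {σ : ℤ → G}

theorem ne_one_delta (h : RigidSeq S Δ p l σ) (hG : IsGarsideSystem S Δ) : Δ ≠ 1 := by
  rintro rfl
  exact h.ne_one 0 (hG.eq_one_of_leftLE_one (IsGarsideSystem.subset_pos (h.mem 0))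
    (hG.leftLE_delta (h.mem 0)))

theorem tau_zpow (h : RigidSeq S Δ p l σ) (hG : IsGarsideSystem S Δ) (j : ℤ) :
    RigidSeq S Δ p l fun k => (tau Δ ^ j) (σ k) where
  pos := h.pos
  mem i := hG.tau_zpow_mem j (h.mem i)
  ne_one i := by simpa using h.ne_one i
  ne_delta i := by
    have hΔ : (tau Δ ^ j) Δ = Δ := by simpa using tau_zpow_delta_zpow (Δ := Δ) j 1
    exact fun e => h.ne_delta i ((tau Δ ^ j).injective (e.trans hΔ.symm))
  weighted i := hG.tau_zpow_leftWeighted j (h.weighted i)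
  periodic i := by rw [h.periodic, tau_zpow_tau_zpow, tau_zpow_tau_zpow, add_comm]

theorem elt_tau_zpow (σ : ℤ → G) (i j : ℤ) :
    elt Δ p l (fun k => (tau Δ ^ j) (σ k)) i = (tau Δ ^ j) (elt Δ p l σ i) := by
  rw [elt, elt, seg_comp (tau Δ ^ j), map_mul, tau_zpow_delta_zpow,
    map_list_prod]

variable (h : RigidSeq S Δ p l σ)
include h

theorem elt_add (i : ℤ) : elt Δ p l σ (i + l) = (tau Δ ^ (-p)) (elt Δ p l σ i) := by
  rw [← elt_tau_zpow, elt, elt, ← seg_shift]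
  simp_rw [h.periodic]

theorem tau_zpow_apply_add (i : ℤ) : (tau Δ ^ p) (σ (i + l)) = σ i := by
  rw [h.periodic, tau_zpow_tau_zpow]
  simp

/-- The window of length `l + 1` splits at either end, and periodicity reads `Δ ^ p * σ i = σ (i +
l) * Δ ^ p`. -/
theorem elt_mul (i : ℤ) : elt Δ p l σ i * σ (i + l) = σ (i + l) * elt Δ p l σ (i + 1) := by
  have e : (seg σ i l).prod * σ (i + l) = σ i * (seg σ (i + 1) l).prod := by
    rw [← List.prod_cons, ← seg, seg_succ_last, List.prod_append, List.prod_singleton]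
  rw [elt, elt, mul_assoc, e, ← mul_assoc, ← mul_assoc, mul_delta_zpow, h.tau_zpow_apply_add]

theorem conj_next (i : ℤ) :
    (σ (i + l))⁻¹ * elt Δ p l σ i * σ (i + l) = elt Δ p l σ (i + 1) := by
  rw [mul_assoc, h.elt_mul, inv_mul_cancel_left]

/-- Conjugation by `σ (i + l)` is the shift and `σ (i + l) * ∂ (σ (i + l)) = Δ`, so the complement
undoes the shift and then applies `τ`. -/
theorem conj_compl (i : ℤ) :
    (compl Δ (σ (i + l)))⁻¹ * elt Δ p l σ (i + 1) * compl Δ (σ (i + l)) =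
      tau Δ (elt Δ p l σ i) := by
  rw [← h.conj_next, compl, tau_apply]
  group

theorem delta_notMem_seg (i : ℤ) (n : ℕ) : Δ ∉ seg σ i n := by
  intro hs
  obtain ⟨k, hk⟩ := exists_of_mem_seg hs
  exact h.ne_delta k hk.symm

variable (hG : IsGarsideSystem S Δ)
include hG

theorem isLeftNormal_seg (i : ℤ) (n : ℕ) : IsLeftNormal S Δ (seg σ i n) := by
  refine hG.isLeftNormal_iff.2 ⟨fun s hs => ?_, isChain_seg h.weighted i n⟩
  obtain ⟨k, rfl⟩ := exists_of_mem_seg hs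
  exact ⟨h.mem k, h.ne_one k⟩

theorem infimum_elt (i : ℤ) : infimum S Δ (elt Δ p l σ i) = p :=
  hG.infimum_eq (h.ne_one_delta hG) (h.isLeftNormal_seg hG i l) (h.delta_notMem_seg i l) p

theorem factors_elt (i : ℤ) : factors S Δ (elt Δ p l σ i) = seg σ i l :=
  hG.factors_eq (h.ne_one_delta hG) (h.isLeftNormal_seg hG i l) (h.delta_notMem_seg i l) p

theorem firstFactor_elt (i : ℤ) : firstFactor S Δ (elt Δ p l σ i) = σ i := by
  rw [firstFactor, h.factors_elt hG]
  obtain ⟨n, rfl⟩ := Nat.exists_eq_add_one.2 h.pos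
  rfl

theorem lastFactor_elt (i : ℤ) : lastFactor S Δ (elt Δ p l σ (i + 1)) = σ (i + l) := by
  rw [lastFactor, h.factors_elt hG]
  obtain ⟨n, rfl⟩ := Nat.exists_eq_add_one.2 h.pos
  simp [seg_succ_last, add_assoc, add_comm (1 : ℤ)]

theorem cycling_elt (i : ℤ) : cycling S Δ (elt Δ p l σ i) = elt Δ p l σ (i + 1) := by
  rw [cycling, h.infimum_elt hG, h.firstFactor_elt hG, h.factors_elt hG, elt, ← h.periodic]
  obtain ⟨n, rfl⟩ := Nat.exists_eq_add_one.2 h.pos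
  rw [seg_succ_last σ (i + 1), seg, List.tail_cons, List.prod_append, List.prod_singleton,
    mul_assoc, Nat.cast_succ, add_assoc, add_comm 1]

theorem decycling_elt (i : ℤ) : decycling S Δ (elt Δ p l σ (i + 1)) = elt Δ p l σ i := by
  rw [decycling, h.infimum_elt hG, h.lastFactor_elt hG, h.factors_elt hG, elt,
    h.tau_zpow_apply_add]
  obtain ⟨n, rfl⟩ := Nat.exists_eq_add_one.2 h.pos
  rw [seg_succ_last, List.dropLast_concat, seg, List.prod_cons, mul_assoc]

theorem delta_zpow_leftLE_elt (i : ℤ) : LeftLE S (Δ ^ p) (elt Δ p l σ i) :=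
  leftLE_mul_right (list_prod_mem_pos fun x hx => ((h.isLeftNormal_seg hG i l).mem x hx).1)

theorem elt_leftLE_delta_zpow (i : ℤ) : LeftLE S (elt Δ p l σ i) (Δ ^ (p + l)) := by
  rw [elt, hG.leftLE_delta_zpow_iff_of_normal (h.ne_one_delta hG) (h.isLeftNormal_seg hG i l),
    length_seg]

end RigidSeq

end RigidSeq

end Garside

namespace Garside

/-! ### The simple elements that conjugate a window into the same interval. -/

section Labels

variable {G : Type*} [Group G] {S : Set G} {Δ : G}

theorem IsGarsideSystem.isLeftNormal_concat (hG : IsGarsideSystem S Δ) {L : List G} {a b : G}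
    (h : IsLeftNormal S Δ (L ++ [a])) (hb : b ∈ S) (hb1 : b ≠ 1)
    (hab : ∀ w, LeftWeighted S Δ w a → LeftWeighted S Δ w b) : IsLeftNormal S Δ (L ++ [b]) := by
  rw [hG.isLeftNormal_iff, List.isChain_append] at h ⊢
  obtain ⟨hm, h₁, -, h₂⟩ := h
  refine ⟨?_, h₁, .singleton _, fun x hx y hy => ?_⟩
  · rw [List.forall_mem_append] at hm ⊢
    exact ⟨hm.1, by simpa using ⟨hb, hb1⟩⟩
  · obtain rfl : b = y := by simpa using hy
    exact hab x (h₂ x hx a (by simp))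

theorem IsSpindle.isLeftNormal_suffix (hG : IsSpindle S Δ) {t u : G} {L : List G}
    (ht : t ∈ posMonoid S) (hu : u ∈ posMonoid S) (hu1 : u ≠ 1) (hΔ : t * u ≠ Δ)
    (h : IsLeftNormal S Δ (t * u :: L)) : IsLeftNormal S Δ (u :: L) := by
  rw [hG.isLeftNormal_iff, List.isChain_cons] at h ⊢
  obtain ⟨hm, h₁, h₂⟩ := h
  obtain ⟨htu, hL⟩ := List.forall_mem_cons.1 hm
  refine ⟨List.forall_mem_cons.2 ⟨⟨hG.mem_of_rightLE htu.1 hu ⟨t, ht, rfl⟩, hu1⟩, hL⟩,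
    fun y hy => ?_, h₂⟩
  exact hG.leftWeighted_of_suffix ht hu htu.1 (hL y (List.mem_of_mem_head? hy)).1 hΔ hu1 (h₁ y hy)

namespace RigidSeq

variable {p : ℤ} {n : ℕ} {σ : ℤ → G}

/-- Windows have length `n + 1`: `σ (i + n)` is the last factor, and the next term `σ (i + n + 1)`
is carried by `τ ^ p` to the first factor `σ i`. -/
theorem leftLE_next_iff (h : RigidSeq S Δ p (n + 1) σ) (hG : IsSpindle S Δ) {i : ℤ} {s : G} :
    LeftLE S ((tau Δ ^ p) s) (σ i) ↔ LeftLE S s (σ (i + n + 1)) := by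
  rw [← h.tau_zpow_apply_add i, hG.tau_zpow_leftLE_iff, Nat.cast_succ, add_assoc]

theorem next_leftLE_iff (h : RigidSeq S Δ p (n + 1) σ) (hG : IsSpindle S Δ) {i : ℤ} {s : G} :
    LeftLE S (σ i) ((tau Δ ^ p) s) ↔ LeftLE S (σ (i + n + 1)) s := by
  rw [← h.tau_zpow_apply_add i, hG.tau_zpow_leftLE_iff, Nat.cast_succ, add_assoc]

theorem conj_elt (s : G) (i : ℤ) (l : ℕ) : s⁻¹ * elt Δ p l σ i * s =
    Δ ^ p * (((tau Δ ^ p) s)⁻¹ * (seg σ i l).prod * s) := by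
  rw [elt, tau_zpow_apply]
  group

/-- The case where `s` extends the normal form on the right. -/
theorem label_of_coprime (h : RigidSeq S Δ p (n + 1) σ) (hG : IsSpindle S Δ) {i : ℤ} {s : G}
    (hs : s ∈ S) (hs1 : s ≠ 1) (hc : LeftWeighted S Δ (σ (i + n)) s)
    (h₁ : LeftLE S (Δ ^ p) (s⁻¹ * elt Δ p (n + 1) σ i * s))
    (h₂ : LeftLE S (s⁻¹ * elt Δ p (n + 1) σ i * s) (Δ ^ (p + (n + 1 : ℕ)))) :
    s = σ (i + n + 1) := by
  have ht := hG.tau_zpow_mem p hs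
  have N : IsLeftNormal S Δ (seg σ i (n + 1) ++ [s]) := by
    refine hG.isLeftNormal_iff.2 ⟨?_, isChain_seg_concat h.weighted fun _ => ?_⟩
    · rw [List.forall_mem_append]
      exact ⟨(h.isLeftNormal_seg hG.toIsGarsideSystem i _).mem, by simpa using ⟨hs, hs1⟩⟩
    · simpa [add_sub_assoc] using hc
  rw [conj_elt] at h₁ h₂
  -- The lower bound says that `τ ^ p s` divides the product of the extended normal form, hence its
  -- head.
  have htσ : LeftLE S ((tau Δ ^ p) s) (σ i) := by
    refine N.2.2.1.2.2.2 _ (IsGarsideSystem.subset_pos ht) (hG.leftLE_delta ht) ?_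
    rw [← leftLE_mul_iff (Δ ^ p * ((tau Δ ^ p) s)⁻¹)]
    simpa [seg, mul_assoc] using h₁
  obtain ⟨u, hu, hσ⟩ := id htσ
  by_cases hu1 : u = 1
  · rw [hu1, mul_one, ← h.tau_zpow_apply_add] at hσ
    rw [← (tau Δ ^ p).injective hσ, Nat.cast_succ, add_assoc]
  -- Cancelling `τ ^ p s` would leave a nontrivial suffix `u` of the head, and a normal form with `n
  -- + 2` factors, too long for the upper bound.
  · exfalso
    rw [seg, List.cons_append, hσ] at N
    have N' := hG.isLeftNormal_suffix (IsGarsideSystem.subset_pos ht) hu hu1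
      (hσ ▸ h.ne_delta i) N
    have e : ((tau Δ ^ p) s)⁻¹ * (seg σ i (n + 1)).prod * s =
        (u :: (seg σ (i + 1) n ++ [s])).prod := by
      rw [seg, List.prod_cons, hσ]
      simp [mul_assoc]
    rw [e, hG.leftLE_delta_zpow_iff_of_normal (h.ne_one_delta hG.toIsGarsideSystem) N'] at h₂
    simp [length_seg] at h₂

/-- The case where the last factor times `s` is simple. -/
theorem label_of_leftLE (h : RigidSeq S Δ p (n + 1) σ) (hG : IsSpindle S Δ) {i : ℤ} {s : G}
    (hs : s ∈ S) (hs1 : s ≠ 1) (hc : LeftLE S s (compl Δ (σ (i + n))))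
    (h₁ : LeftLE S (Δ ^ p) (s⁻¹ * elt Δ p (n + 1) σ i * s)) :
    s = compl Δ (σ (i + n)) := by
  have hsp := IsGarsideSystem.subset_pos hs
  have ht := hG.tau_zpow_mem p hs
  have htp := IsGarsideSystem.subset_pos ht
  have hz := h.mem (i + n)
  have hzp := IsGarsideSystem.subset_pos hz
  have hw := h.weighted (i + n)
  by_contra hne
  have ha : σ (i + n) * s ∈ S := by
    refine hG.mem_iff_leftLE.2 ⟨mul_mem hzp hsp, ?_⟩
    rwa [← leftLE_mul_iff (σ (i + n)), mul_compl] at hc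
  have haΔ : σ (i + n) * s ≠ Δ := fun e => hne (by rw [compl, ← e]; group)
  have hza : LeftLE S (σ (i + n)) (σ (i + n) * s) := leftLE_mul_right hsp
  have ha1 : σ (i + n) * s ≠ 1 := fun e => h.ne_one _ (hG.eq_one_of_mul_eq_one hzp hsp e)
  have N := h.isLeftNormal_seg hG.toIsGarsideSystem i (n + 1)
  rw [seg_succ_last] at N
  -- Since `s ≠ ∂ z`, the product `z * s` is simple and not `Δ`; it may replace the last factor `z`
  -- of the normal form.
  replace N := hG.isLeftNormal_concat N ha ha1 fun w hw =>
    hG.leftWeighted_of_prefix hz ha haΔ (h.ne_one _) hza hw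
  have hle : LeftLE S ((tau Δ ^ p) s) (seg σ i n ++ [σ (i + n) * s]).prod := by
    rw [conj_elt, ← mul_one (Δ ^ p)] at h₁
    rw [← leftLE_mul_iff (Δ ^ p * ((tau Δ ^ p) s)⁻¹)]
    simpa [seg_succ_last, mul_assoc] using h₁
  -- For windows of length one the head itself has been enlarged to `z * s`, so only comparability
  -- is available.
  have hcmp : LeftLE S ((tau Δ ^ p) s) (σ i) ∨ LeftLE S (σ i) ((tau Δ ^ p) s) := by
    cases n with
    | zero =>
      refine hG.comparable htp (IsGarsideSystem.subset_pos (h.mem i)) ha haΔ ?_ ?_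
      · simpa [seg] using hle
      · simpa using hza
    | succ n => exact .inl (N.2.2.1.2.2.2 _ htp (hG.leftLE_delta ht) (by simpa [seg] using hle))
  rcases hcmp with hcmp | hcmp
  · exact hs1 (hw s hsp hc ((h.leftLE_next_iff hG).1 hcmp))
  · exact h.ne_one _ (hw _ (IsGarsideSystem.subset_pos (h.mem _))
      (((h.next_leftLE_iff hG).1 hcmp).trans hc) (LeftLE.refl _))

/-- The case where the last factor times `s` is divisible by `Δ`. -/
theorem label_of_compl_leftLE (h : RigidSeq S Δ p (n + 1) σ) (hG : IsSpindle S Δ) {i : ℤ} {s : G}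
    (hs : s ∈ S) (hsΔ : s ≠ Δ) (hc : LeftLE S (compl Δ (σ (i + n))) s)
    (h₂ : LeftLE S (s⁻¹ * elt Δ p (n + 1) σ i * s) (Δ ^ (p + (n + 1 : ℕ)))) :
    s = compl Δ (σ (i + n)) := by
  have ht := hG.tau_zpow_mem p hs
  have hz := h.mem (i + n)
  have hw := h.weighted (i + n)
  have hcz := IsGarsideSystem.subset_pos (hG.compl_mem hz)
  have hcz1 : compl Δ (σ (i + n)) ≠ 1 := by
    rw [compl, Ne, inv_mul_eq_one]
    exact h.ne_delta _
  have hxp := IsGarsideSystem.subset_pos (h.mem (i + n + 1))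
  obtain ⟨v, hv, hsv⟩ := id hc
  by_contra hne
  have hv1 : v ≠ 1 := by
    rintro rfl
    exact hne (by simpa using hsv)
  have hvτ : LeftLE S v (tau Δ (σ (i + n))) := by
    refine ⟨compl Δ s, IsGarsideSystem.subset_pos (hG.compl_mem hs), ?_⟩
    rw [← compl_compl, hsv]
    simp only [compl]
    group
  have hτ (k : ℤ) : tau Δ (σ k) = (tau Δ ^ (1 : ℤ)) (σ k) := by rw [zpow_one]
  -- Otherwise `s` would be comparable with the next term of `σ`, which would then be comparable
  -- with `∂ z`, against weightedness.
  have hcop : LeftCoprime S ((tau Δ ^ p) s) (σ i) := by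
    rcases hG.comparable_or_coprime ht (h.mem i) with hcmp | hcmp | hcmp
    · exact absurd (hw _ hcz (LeftLE.refl _)
        (hc.trans ((h.leftLE_next_iff hG).1 hcmp))) hcz1
    · rcases hG.comparable hcz hxp hs hsΔ hc ((h.next_leftLE_iff hG).1 hcmp) with hcmp' | hcmp'
      · exact absurd (hw _ hcz (LeftLE.refl _) hcmp') hcz1
      · exact absurd (hw _ hxp hcmp' (LeftLE.refl _)) (h.ne_one _)
    · exact hcmp
  have hτσ := h.tau_zpow hG.toIsGarsideSystem 1
  have ht1 : compl Δ ((tau Δ ^ p) s) ≠ 1 := by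
    rw [← tau_zpow_compl, Ne, EmbeddingLike.map_eq_one_iff, compl, inv_mul_eq_one]
    exact hsΔ
  have N : IsLeftNormal S Δ
      (compl Δ ((tau Δ ^ p) s) :: seg (fun k => (tau Δ ^ (1 : ℤ)) (σ k)) i (n + 1)) := by
    have N₀ := hG.isLeftNormal_iff.1 (hτσ.isLeftNormal_seg hG.toIsGarsideSystem i (n + 1))
    refine hG.isLeftNormal_iff.2 ⟨List.forall_mem_cons.2 ⟨⟨hG.compl_mem ht, ht1⟩, N₀.1⟩,
      List.isChain_cons_cons.2 ⟨?_, N₀.2⟩⟩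
    rw [LeftWeighted, compl_compl]
    simpa using hG.tau_zpow_coprime 1 hcop
  rw [seg_succ_last, ← List.cons_append] at N
  replace N := hG.isLeftNormal_concat N
    (hG.mem_of_leftLE (hG.tau_mem hz) hv hvτ) hv1
    fun w hw => hw.mono (LeftLE.refl _) (by rwa [← hτ])
  -- With `s = ∂ z * v`, the product `z * s` is `Δ * v`. Moving this `Δ` to the front applies `τ` to
  -- the other factors and turns `(τ ^ p s)⁻¹` into `∂ (τ ^ p s)`, giving `n + 2` normal factors,
  -- one too many.
  have e : ((tau Δ ^ p) s)⁻¹ * (seg σ i (n + 1)).prod * s =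
      (compl Δ ((tau Δ ^ p) s) :: seg (fun k => (tau Δ ^ (1 : ℤ)) (σ k)) i n ++ [v]).prod := by
    rw [seg_comp, List.prod_append, List.prod_cons, ← map_list_prod, seg_succ_last,
      List.prod_append, hsv, tau_zpow_apply 1]
    simp only [List.prod_singleton, compl]
    group
  rw [conj_elt, e,
    hG.leftLE_delta_zpow_iff_of_normal (h.ne_one_delta hG.toIsGarsideSystem) N] at h₂
  simp [length_seg] at h₂

theorem label_cases (h : RigidSeq S Δ p (n + 1) σ) (hG : IsSpindle S Δ) {i : ℤ} {s : G}
    (hs : s ∈ S) (h₁ : LeftLE S (Δ ^ p) (s⁻¹ * elt Δ p (n + 1) σ i * s))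
    (h₂ : LeftLE S (s⁻¹ * elt Δ p (n + 1) σ i * s) (Δ ^ (p + (n + 1 : ℕ)))) :
    s = 1 ∨ s = Δ ∨ s = σ (i + n + 1) ∨ s = compl Δ (σ (i + n)) := by
  by_cases hs1 : s = 1
  · exact .inl hs1
  by_cases hsΔ : s = Δ
  · exact .inr (.inl hsΔ)
  rcases hG.comparable_or_coprime (hG.compl_mem (h.mem (i + n))) hs with hc | hc | hc
  · exact .inr (.inr (.inr (h.label_of_compl_leftLE hG hs hsΔ hc h₂)))
  · exact .inr (.inr (.inr (h.label_of_leftLE hG hs hs1 hc h₁)))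
  · exact .inr (.inr (.inl (h.label_of_coprime hG hs hs1 hc h₁ h₂)))

end RigidSeq

end Labels

end Garside

namespace Garside

/-! ### Super summit sets, their connectedness, and the finite order of `τ`. -/

section SuperSummit

variable {G : Type*} [Group G] {S : Set G} {Δ : G}

theorem factors_spec {b : G} (h : factors S Δ b ≠ []) :
    IsLeftNormal S Δ (factors S Δ b) ∧ b = Δ ^ infimum S Δ b * (factors S Δ b).prod := by
  have hex : ∃ L, IsLeftNormal S Δ L ∧ b = Δ ^ infimum S Δ b * L.prod := by
    by_contra hex
    exact h (dif_neg hex)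
  rw [show factors S Δ b = hex.choose from dif_pos hex]
  exact hex.choose_spec

theorem tau_zpow_conj (k : ℤ) (b x : G) : IsConj b ((tau Δ ^ k) x) ↔ IsConj b x := by
  have h : IsConj x ((tau Δ ^ k) x) :=
    isConj_iff.2 ⟨Δ ^ (-k), by rw [tau_zpow_apply]; group⟩
  exact ⟨fun h' => h'.trans h.symm, fun h' => h'.trans h⟩

theorem isConj_conj (b x s : G) : IsConj b (s⁻¹ * x * s) ↔ IsConj b x := by
  have h : IsConj x (s⁻¹ * x * s) := isConj_iff.2 ⟨s⁻¹, by group⟩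
  exact ⟨fun h' => h'.trans h.symm, fun h' => h'.trans h⟩

theorem exists_dvd_simple {g : G} (hg : g ∈ posMonoid S) (hg1 : g ≠ 1) :
    ∃ s ∈ S, s ≠ 1 ∧ LeftLE S s g := by
  induction hg using Submonoid.closure_induction_left with
  | one => exact absurd rfl hg1
  | mul_left x hx y hy ih =>
    by_cases h1 : x = 1
    · simpa [h1] using ih (by simpa [h1] using hg1)
    · exact ⟨x, hx, h1, leftLE_mul_right hy⟩

namespace IsGarsideSystem

variable (hG : IsGarsideSystem S Δ)
include hG

/-- A factor `Δ` can only be preceded by `Δ`, because `∂ s` always divides `Δ`. -/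
theorem delta_notMem_of_head {s : G} {L : List G} (h : IsLeftNormal S Δ (s :: L)) (hs : s ≠ Δ) :
    Δ ∉ s :: L := by
  induction L generalizing s with
  | nil => simpa using hs.symm
  | cons t L ih =>
    have hw := (List.isChain_cons_cons.1 (hG.isLeftNormal_iff.1 h).2).1
    have hc := hG.compl_mem h.1
    have ht : t ≠ Δ := by
      rintro rfl
      have h1 := hw _ (subset_pos hc) (LeftLE.refl _) (hG.leftLE_delta hc)
      rw [compl, inv_mul_eq_one] at h1
      exact hs h1
    exact List.not_mem_cons_of_ne_of_not_mem hs.symm (ih h.2.2.2 ht)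

theorem delta_notMem_factors (hΔ : Δ ≠ 1) {b : G} (h : factors S Δ b ≠ []) :
    Δ ∉ factors S Δ b := by
  obtain ⟨h₁, h₂⟩ := factors_spec h
  generalize factors S Δ b = F at *
  cases F with
  | nil => exact absurd rfl h
  | cons s L =>
    refine hG.delta_notMem_of_head h₁ ?_
    rintro rfl
    have : infimum S s b + 1 ≤ infimum S s b := by
      rw [← hG.delta_zpow_leftLE_iff hΔ]
      nth_rw 2 [h₂]
      rw [zpow_add, leftLE_mul_iff, List.prod_cons, zpow_one]
      exact leftLE_mul_right (list_prod_mem_pos fun x hx => (h₁.2.2.2.mem x hx).1)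
    omega

theorem supremum_eq_infimum_add_cl (hΔ : Δ ≠ 1) {b : G} (h : factors S Δ b ≠ []) :
    supremum S Δ b = infimum S Δ b + cl S Δ b := by
  obtain ⟨h₁, h₂⟩ := factors_spec h
  conv_lhs => rw [h₂]
  rw [hG.supremum_eq hΔ h₁, cl]

theorem le_of_isConj {b y : G} (hb : b ∈ SSS S Δ b) (hΔ : Δ ≠ 1) (hy : IsConj b y) :
    infimum S Δ y ≤ infimum S Δ b ∧ supremum S Δ b ≤ supremum S Δ y := by
  obtain ⟨-, p, q, hp, hq, h₁, h₂⟩ := hb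
  exact ⟨(hp.2 ⟨y, hy, rfl⟩).trans ((hG.delta_zpow_leftLE_iff hΔ).1 h₁),
    ((hG.leftLE_delta_zpow_iff hΔ).1 h₂).trans (hq.2 ⟨y, hy, rfl⟩)⟩

/-- As `b` lies in its own super summit set, the extremal `inf` and `sup` are attained at `b`. -/
theorem mem_SSS_iff {b x : G} (hb : b ∈ SSS S Δ b) (hΔ : Δ ≠ 1) :
    x ∈ SSS S Δ b ↔ IsConj b x ∧ LeftLE S (Δ ^ infimum S Δ b) x ∧
      LeftLE S x (Δ ^ supremum S Δ b) := by
  have hp : IsGreatest (infimum S Δ '' {y | IsConj b y}) (infimum S Δ b) :=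
    ⟨⟨b, IsConj.refl b, rfl⟩, by rintro _ ⟨y, hy, rfl⟩; exact (hG.le_of_isConj hb hΔ hy).1⟩
  have hq : IsLeast (supremum S Δ '' {y | IsConj b y}) (supremum S Δ b) :=
    ⟨⟨b, IsConj.refl b, rfl⟩, by rintro _ ⟨y, hy, rfl⟩; exact (hG.le_of_isConj hb hΔ hy).2⟩
  constructor
  · rintro ⟨hx, p, q, hp', hq', h₁, h₂⟩
    rw [hp.unique hp', hq.unique hq']
    exact ⟨hx, h₁, h₂⟩
  · rintro ⟨hx, h₁, h₂⟩
    exact ⟨hx, _, _, hp, hq, h₁, h₂⟩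

/-- The conclusion is equivalent to `x⁻¹ * s * Δ ^ p ≼ s`, so it suffices to bound the left side by
`Δ` and by `g`. -/
theorem delta_zpow_leftLE_conj_gcd {x g s : G} {p : ℤ} (hg : g ∈ posMonoid S)
    (hs : IsLeftGcd S Δ g s) (hx : LeftLE S (Δ ^ p) x) (hxg : LeftLE S (Δ ^ p) (g⁻¹ * x * g)) :
    LeftLE S (Δ ^ p) (s⁻¹ * x * s) := by
  have h₁ : LeftLE S (x⁻¹ * (s * Δ ^ p)) Δ := by
    rw [← leftLE_mul_iff x, mul_inv_cancel_left]
    refine ((hG.mul_delta_zpow_leftLE_iff p).2 hs.2.1).trans ?_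
    rw [← zpow_one_add, add_comm, zpow_add]
    simpa using (hG.mul_delta_zpow_leftLE_iff 1).2 hx
  have h₂ : LeftLE S (x⁻¹ * (s * Δ ^ p)) g := by
    rw [← leftLE_mul_iff x, mul_inv_cancel_left]
    refine ((hG.mul_delta_zpow_leftLE_iff p).2 hs.2.2.1).trans ?_
    rw [← leftLE_mul_iff g] at hxg
    simpa [mul_assoc] using hxg
  have h₃ := hG.leftLE_of_isLeftGcd hG.delta_mem hg hs h₁ h₂
  rw [← leftLE_mul_iff (s⁻¹ * x)] at h₃
  simpa [mul_assoc] using h₃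

theorem conj_gcd_leftLE_delta_zpow {x g s : G} {q : ℤ} (hg : g ∈ posMonoid S)
    (hs : IsLeftGcd S Δ g s) (hx : LeftLE S x (Δ ^ q)) (hxg : LeftLE S (g⁻¹ * x * g) (Δ ^ q)) :
    LeftLE S (s⁻¹ * x * s) (Δ ^ q) := by
  have h₁ : LeftLE S (x * s * Δ ^ (-q)) Δ := by
    refine ((hG.mul_delta_zpow_leftLE_iff (-q)).2 ((leftLE_mul_iff x).2 hs.2.1)).trans ?_
    rw [← hG.mul_delta_zpow_leftLE_iff (q - 1)]
    have e₁ : x * Δ * Δ ^ (-q) * Δ ^ (q - 1) = x := by group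
    have e₂ : Δ * Δ ^ (q - 1) = Δ ^ q := by rw [← zpow_one_add, add_sub_cancel]
    rwa [e₁, e₂]
  have h₂ : LeftLE S (x * s * Δ ^ (-q)) g := by
    refine ((hG.mul_delta_zpow_leftLE_iff (-q)).2 ((leftLE_mul_iff x).2 hs.2.2.1)).trans ?_
    rw [← hG.mul_delta_zpow_leftLE_iff q]
    rw [← leftLE_mul_iff g] at hxg
    simpa [mul_assoc] using hxg
  have h₃ := hG.leftLE_of_isLeftGcd hG.delta_mem hg hs h₁ h₂
  rw [← hG.mul_delta_zpow_leftLE_iff q, ← leftLE_mul_iff s⁻¹] at h₃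
  simpa [mul_assoc] using h₃

/-- Connectedness of super summit sets: a subset of `[Δ ^ p, Δ ^ q]` closed under those
conjugations by simple elements that stay in `[Δ ^ p, Δ ^ q]` is closed under all conjugations by
positive elements that stay there. -/
theorem conj_mem_of_simple_conj_mem {A : Set G} {p q : ℤ}
    (hA : ∀ x ∈ A, LeftLE S (Δ ^ p) x ∧ LeftLE S x (Δ ^ q))
    (hstep : ∀ x ∈ A, ∀ s ∈ S, LeftLE S (Δ ^ p) (s⁻¹ * x * s) →
      LeftLE S (s⁻¹ * x * s) (Δ ^ q) → s⁻¹ * x * s ∈ A)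
    {x g : G} (hg : g ∈ posMonoid S) (hx : x ∈ A) (h₁ : LeftLE S (Δ ^ p) (g⁻¹ * x * g))
    (h₂ : LeftLE S (g⁻¹ * x * g) (Δ ^ q)) : g⁻¹ * x * g ∈ A := by
  obtain ⟨n, hn⟩ := hG.exists_length_bound hg
  induction n generalizing x g with
  | zero =>
    by_cases hg1 : g = 1
    · simpa [hg1] using hx
    · simpa using hn [g] (by simpa using ⟨hg, hg1⟩) (by simp)
  | succ n ih =>
    by_cases hg1 : g = 1
    · simpa [hg1] using hx
    -- Conjugating by `s = Δ ∧ g` stays in the interval, and the remaining quotient of `g` has a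
    -- smaller length bound.
    obtain ⟨s, hsS, hs⟩ := hG.exists_gcd_delta hg
    have hs1 : s ≠ 1 := by
      rintro rfl
      obtain ⟨t, ht, ht1, htg⟩ := exists_dvd_simple hg hg1
      exact ht1 (hG.eq_one_of_leftLE_one (subset_pos ht)
        (hs.2.2.2 t (subset_pos ht) (hG.leftLE_delta ht) htg))
    have hxs := hstep x hx s hsS
      (hG.delta_zpow_leftLE_conj_gcd hg hs (hA x hx).1 h₁)
      (hG.conj_gcd_leftLE_delta_zpow hg hs (hA x hx).2 h₂)
    obtain ⟨g', hg', rfl⟩ := hs.2.2.1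
    have e : (s * g')⁻¹ * x * (s * g') = g'⁻¹ * (s⁻¹ * x * s) * g' := by group
    rw [e] at h₁ h₂ ⊢
    refine ih hg' hxs h₁ h₂ fun L hL hLp => ?_
    have := hn (s :: L) (List.forall_mem_cons.2 ⟨⟨subset_pos hsS, hs1⟩, hL⟩) (by simp [hLp])
    simpa using this

/-- `τ` maps the finite set `S` into itself injectively, so it has finite order on each generator;
periods multiply under products. -/
theorem exists_tau_pow_apply_eq (g : G) : ∃ n : ℕ, 0 < n ∧ (tau Δ ^ n) g = g := by
  have hg : g ∈ Subgroup.closure S := hG.generates ▸ Subgroup.mem_top g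
  induction hg using Subgroup.closure_induction with
  | mem s hs =>
    obtain ⟨m, n, hmn, h⟩ := hG.finite.exists_lt_map_eq_of_forall_mem
      (f := fun n : ℕ => (tau Δ ^ n) s) fun n => by
        simpa using hG.tau_zpow_mem n hs
    refine ⟨n - m, Nat.sub_pos_of_lt hmn, (tau Δ ^ m).injective ?_⟩
    rw [← MulAut.mul_apply, ← pow_add, Nat.add_sub_cancel' hmn.le]
    exact h.symm
  | one => exact ⟨1, one_pos, map_one _⟩
  | inv x _ hx =>
    obtain ⟨n, hn, h⟩ := hx
    exact ⟨n, hn, by rw [map_inv, h]⟩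
  | mul x y _ _ hx hy =>
    obtain ⟨m, hm, h⟩ := hx
    obtain ⟨n, hn, h'⟩ := hy
    refine ⟨m * n, Nat.mul_pos hm hn, ?_⟩
    have aux {f : MulAut G} {z : G} (hf : f z = z) (k : ℕ) : (f ^ k) z = z := by
      induction k with
      | zero => rfl
      | succ k ih => rw [pow_succ, MulAut.mul_apply, hf, ih]
    rw [map_mul, pow_mul, aux h, ← pow_mul, mul_comm m n, pow_mul, aux h']

theorem ord_pos (b : G) : 0 < ord Δ b := by
  obtain ⟨n, hn, h⟩ := hG.exists_tau_pow_apply_eq b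
  exact Function.IsPeriodicPt.minimalPeriod_pos hn
    (show (tau Δ)^[n] b = b by rw [← hom_coe_pow _ rfl (fun _ _ => rfl)]; exact h)

end IsGarsideSystem

end SuperSummit

end Garside

namespace Garside

/-! ### From super summit elements to periodic sequences. -/

section Rigidity

variable {G : Type*} [Group G] {S : Set G} {Δ : G}

/-- The factors of a rigid element extend to a periodic sequence. -/
theorem IsGarsideSystem.exists_rigidSeq (hG : IsGarsideSystem S Δ) {F : List G} (p : ℤ)
    (hF : F ≠ []) (hN : IsLeftNormal S Δ F) (hΔ : Δ ∉ F)
    (hr : LeftWeighted S Δ (F.getLastD 1) ((tau Δ ^ (-p)) (F.headD 1))) :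
    ∃ σ, RigidSeq S Δ p F.length σ ∧ elt Δ p F.length σ 0 = Δ ^ p * F.prod := by
  have hl : 0 < F.length := List.length_pos_iff.2 hF
  have hl' : (0 : ℤ) < F.length := by exact_mod_cast hl
  let f : ℕ → G := fun k => F.getD k 1
  have hf {k : ℕ} (hk : k < F.length) : f k = F[k] := List.getD_eq_getElem _ _ hk
  -- The quotient counts laps, each twisted by `τ ^ (-p)`. Weightedness inside a lap comes from the
  -- normal form, across laps from `hr`.
  let σ : ℤ → G := fun k => (tau Δ ^ (-p * (k / F.length))) (f (k % F.length).toNat)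
  have hlt (k : ℤ) : (k % F.length).toNat < F.length := by
    have := Int.emod_lt_of_pos k hl'
    have := Int.emod_nonneg k hl'.ne'
    omega
  have hmem (k : ℤ) : f (k % F.length).toNat ∈ F := by
    rw [hf (hlt k)]
    exact List.getElem_mem _
  have hinit {k : ℕ} (hk : k < F.length) : σ k = f k := by
    have h₁ : (k : ℤ) / F.length = 0 := Int.ediv_eq_zero_of_lt (by omega) (by omega)
    have h₂ : (k : ℤ) % F.length = k := Int.emod_eq_of_lt (by omega) (by omega)
    simp only [σ, h₁, h₂, mul_zero, zpow_zero, Int.toNat_natCast, MulAut.one_apply]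
  refine ⟨σ, ⟨hl, fun i => ?_, fun i => ?_, fun i => ?_, fun i => ?_, fun i => ?_⟩, ?_⟩
  · exact hG.tau_zpow_mem _ (hN.mem _ (hmem i)).1
  · simpa [σ] using (hN.mem _ (hmem i)).2
  · intro h
    have hΔ' (j : ℤ) : (tau Δ ^ j) Δ = Δ := by simpa using tau_zpow_delta_zpow (Δ := Δ) j 1
    have := hmem i
    rw [(tau Δ ^ (-p * (i / F.length))).injective (h.trans (hΔ' _).symm)] at this
    exact hΔ this
  · by_cases h : (i % F.length).toNat + 1 < F.length
    · have hm := Int.emod_nonneg i hl'.ne'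
      have hi : i = F.length * (i / F.length) + i % F.length := (Int.mul_ediv_add_emod i _).symm
      have h₁ : (i + 1) / F.length = i / F.length ∧ (i + 1) % F.length = i % F.length + 1 :=
        (Int.ediv_emod_unique hl').2 ⟨by linarith, by omega, by omega⟩
      have h₂ : (i % F.length + 1).toNat = (i % F.length).toNat + 1 := by omega
      simp only [σ, h₁.1, h₁.2, h₂]
      refine hG.tau_zpow_leftWeighted _ ?_
      rw [hf (hlt i), hf h]
      exact List.isChain_iff_getElem.1 (hG.isLeftNormal_iff.1 hN).2 _ h
    · have hm := Int.emod_nonneg i hl'.ne'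
      have hm' := hlt i
      have hi : i = F.length * (i / F.length) + i % F.length := (Int.mul_ediv_add_emod i _).symm
      have hm'' : i % F.length = F.length - 1 := by omega
      have h₁ : (i + 1) / F.length = i / F.length + 1 ∧ (i + 1) % F.length = 0 :=
        (Int.ediv_emod_unique hl').2 ⟨by linarith, by omega, by omega⟩
      have h₂ : (i % F.length).toNat = F.length - 1 := by omega
      simp only [σ, h₁.1, h₁.2, h₂]
      rw [mul_add, mul_one, ← tau_zpow_tau_zpow]
      refine hG.tau_zpow_leftWeighted _ ?_
      have hhead : f (0 : ℤ).toNat = F.headD 1 := by cases F <;> simp [f]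
      have hlast : f (F.length - 1) = F.getLastD 1 := by
        simp [f, List.getLastD_eq_getLast?, List.getLast?_eq_getElem?]
      rwa [hhead, hlast]
  · have h₁ : (i + F.length) / F.length = i / F.length + 1 := by
      rw [Int.add_ediv_of_dvd_right (dvd_refl _), Int.ediv_self hl'.ne']
    simp only [σ, h₁, Int.add_emod_right]
    rw [tau_zpow_tau_zpow]
    congr 2
    ring
  · rw [elt]
    congr 2
    refine List.ext_getElem (length_seg _ _ _) fun k hk hk' => ?_
    rw [getElem_seg, zero_add, hinit hk', hf hk']

/-- Elements of canonical length at least two in their super summit set are rigid. -/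
theorem IsSpindle.leftWeighted_of_mem_SSS (hG : IsSpindle S Δ) (hΔ : Δ ≠ 1) {b : G}
    (hb : b ∈ SSS S Δ b) (hl : 2 ≤ cl S Δ b) :
    LeftWeighted S Δ (lastFactor S Δ b) ((tau Δ ^ (-infimum S Δ b)) (firstFactor S Δ b)) := by
  have hF : factors S Δ b ≠ [] := by
    intro h
    simp [cl, h] at hl
  obtain ⟨hN, he⟩ := factors_spec hF
  have hsup := hG.supremum_eq_infimum_add_cl hΔ hF
  have hmax := fun y => hG.le_of_isConj (y := y) hb hΔ
  rw [cl] at hl hsup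
  rw [lastFactor, firstFactor]
  generalize factors S Δ b = F at *
  generalize infimum S Δ b = p at *
  obtain ⟨s, M, z, rfl⟩ : ∃ s M z, F = s :: (M ++ [z]) := by
    cases F with
    | nil => simp at hl
    | cons s L =>
      cases L using List.reverseRecOn with
      | nil => simp at hl
      | append_singleton M z => exact ⟨s, M, z, rfl⟩
  have hs := (hN.mem s (by simp)).1
  have hz := (hN.mem z (by simp)).1
  have hM : ∀ x ∈ M, x ∈ S := fun x hx => (hN.mem x (by simp [hx])).1
  have hx := hG.tau_zpow_mem (-p) hs
  -- This is the cycling of `b`. As `l ≥ 2`, `s` and `z` are distinct entries, and cycling makes `z`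
  -- adjacent to the twisted `s`.
  have hconj : IsConj b (Δ ^ p * (M.prod * (z * (tau Δ ^ (-p)) s))) := by
    refine isConj_iff.2 ⟨((tau Δ ^ (-p)) s)⁻¹, ?_⟩
    rw [he, tau_zpow_apply]
    simp
    group
  obtain ⟨hinf, hsup'⟩ := hmax _ hconj
  have e₁ : (s :: (M ++ [z])).headD 1 = s := rfl
  have e₂ : (s :: (M ++ [z])).getLastD 1 = z := by
    rw [List.getLastD_eq_getLast?, ← List.cons_append, List.getLast?_concat]
    rfl
  rw [e₁, e₂]
  -- If `∂ z` divides the twisted `s`, cycling raises `inf`; if the twisted `s` divides `∂ z`, the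
  -- two factors merge and `sup` drops.
  rcases hG.comparable_or_coprime (hG.compl_mem hz) hx with h | h | h
  · exfalso
    obtain ⟨v, hv, hv'⟩ := h
    have : Δ ^ p * (M.prod * (z * (tau Δ ^ (-p)) s)) =
        Δ ^ (p + 1) * ((tau Δ ^ (1 : ℤ)) M.prod * v) := by
      rw [hv', ← mul_assoc z, mul_compl, tau_zpow_apply 1]
      group
    have h₁ := (hG.delta_zpow_leftLE_iff hΔ (g := Δ ^ p * (M.prod * (z * (tau Δ ^ (-p)) s)))
      (k := p + 1)).1 (this ▸ leftLE_mul_right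
        (mul_mem (hG.tau_zpow_mem_pos 1 (list_prod_mem_pos hM)) hv))
    omega
  · exfalso
    have hzx : z * (tau Δ ^ (-p)) s ∈ S := by
      refine hG.mem_iff_leftLE.2 ⟨mul_mem (IsGarsideSystem.subset_pos hz)
        (IsGarsideSystem.subset_pos hx), ?_⟩
      rwa [← leftLE_mul_iff z, mul_compl] at h
    have h₁ := hG.prod_leftLE_delta_pow (L := M ++ [z * (tau Δ ^ (-p)) s]) (by
      rw [List.forall_mem_append]
      exact ⟨hM, by simpa using hzx⟩)
    rw [← leftLE_mul_iff (Δ ^ p), ← zpow_natCast, ← zpow_add, hG.leftLE_delta_zpow_iff hΔ] at h₁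
    simp only [List.length_append, List.length_cons, List.length_nil, List.prod_append,
      List.prod_singleton] at h₁ hsup
    push_cast at h₁ hsup
    omega
  · exact h

theorem IsSpindle.exists_rigidSeq (hG : IsSpindle S Δ) {b : G} (hb : b ∈ SSS S Δ b)
    (hl : 1 ≤ cl S Δ b) (hrigid : cl S Δ b = 1 → IsRigid S Δ b) :
    ∃ σ, RigidSeq S Δ (infimum S Δ b) (cl S Δ b) σ ∧
      elt Δ (infimum S Δ b) (cl S Δ b) σ 0 = b := by
  have hF : factors S Δ b ≠ [] := by
    intro h
    simp [cl, h] at hl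
  obtain ⟨hN, he⟩ := factors_spec hF
  have hΔ : Δ ≠ 1 := by
    rintro rfl
    obtain ⟨s, hs⟩ := List.exists_mem_of_ne_nil _ hF
    obtain ⟨hsS, hs1⟩ := hN.mem s hs
    exact hs1 (hG.eq_one_of_leftLE_one (IsGarsideSystem.subset_pos hsS) (hG.leftLE_delta hsS))
  have hr : LeftWeighted S Δ (lastFactor S Δ b)
      ((tau Δ ^ (-infimum S Δ b)) (firstFactor S Δ b)) := by
    rcases hl.eq_or_lt with hl | hl
    · have h := hrigid hl.symm
      exact fun e he h₁ h₂ => hG.eq_one_of_leftLE_one he (h.2.2.2 e he h₂ h₁)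
    · exact hG.leftWeighted_of_mem_SSS hΔ hb hl
  obtain ⟨σ, hσ, h⟩ := hG.toIsGarsideSystem.exists_rigidSeq (infimum S Δ b) hF hN
    (hG.delta_notMem_factors hΔ hF) hr
  exact ⟨σ, hσ, h.trans he.symm⟩

end Rigidity

end Garside

namespace Garside

/-! ### The grid of cyclings and `τ`-translates, and its periods. -/

section Grid

variable {G : Type*} [Group G] {S : Set G} {Δ : G}

theorem tau_zpow_eq_of_dvd {b : G} {j k : ℤ} (h : (ord Δ b : ℤ) ∣ j - k) :
    (tau Δ ^ j) b = (tau Δ ^ k) b := by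
  have := (MulAction.zpow_smul_eq_iff_minimalPeriod_dvd (a := tau Δ) (b := b)).2 h
  have h₂ : (tau Δ ^ (j - k)) b = b := this
  rw [← sub_add_cancel j k, add_comm, ← tau_zpow_tau_zpow, h₂]

/-- The doubly indexed family `c^i (τ^j b)`, for all integers `i` and `j`. -/
def gridElt (Δ : G) (p : ℤ) (l : ℕ) (σ : ℤ → G) (i j : ℤ) : G := (tau Δ ^ j) (elt Δ p l σ i)

theorem gridElt_eq_elt (p : ℤ) (l : ℕ) (σ : ℤ → G) (i j : ℤ) :
    gridElt Δ p l σ i j = elt Δ p l (fun k => (tau Δ ^ j) (σ k)) i :=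
  (RigidSeq.elt_tau_zpow σ i j).symm

theorem gridElt_add_one_right (p : ℤ) (l : ℕ) (σ : ℤ → G) (i j : ℤ) :
    gridElt Δ p l σ i (j + 1) = tau Δ (gridElt Δ p l σ i j) := by
  rw [gridElt, gridElt, add_comm, ← tau_zpow_tau_zpow, zpow_one]

theorem conj_delta_gridElt (p : ℤ) (l : ℕ) (σ : ℤ → G) (i j : ℤ) :
    Δ⁻¹ * gridElt Δ p l σ i j * Δ = gridElt Δ p l σ i (j + 1) := by
  rw [gridElt_add_one_right, tau_apply]

namespace RigidSeq

variable {p : ℤ} {l : ℕ} {σ : ℤ → G} (h : RigidSeq S Δ p l σ)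
include h

theorem gridElt_add_left (i j : ℤ) :
    gridElt Δ p l σ (i + l) j = gridElt Δ p l σ i (j - p) := by
  rw [gridElt, gridElt, h.elt_add, tau_zpow_tau_zpow, sub_eq_add_neg]

theorem gridElt_add_mul_left (i j k : ℤ) :
    gridElt Δ p l σ (i + l * k) j = gridElt Δ p l σ i (j - p * k) := by
  induction k generalizing j with
  | zero => simp
  | succ n ih => rw [mul_add, mul_one, ← add_assoc, h.gridElt_add_left, ih]; congr 1; ring
  | pred n ih =>
    have e : i + l * (-n : ℤ) = i + l * (-n - 1) + l := by ring
    have := ih (j + p)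
    rw [e, h.gridElt_add_left, add_sub_cancel_right] at this
    rw [this]
    congr 1
    ring

variable (hG : IsSpindle S Δ)
include hG

theorem cycling_gridElt (i j : ℤ) :
    cycling S Δ (gridElt Δ p l σ i j) = gridElt Δ p l σ (i + 1) j := by
  rw [gridElt_eq_elt, gridElt_eq_elt,
    (h.tau_zpow hG.toIsGarsideSystem j).cycling_elt hG.toIsGarsideSystem]

theorem decycling_gridElt (i j : ℤ) :
    decycling S Δ (gridElt Δ p l σ (i + 1) j) = gridElt Δ p l σ i j := by
  rw [gridElt_eq_elt, gridElt_eq_elt,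
    (h.tau_zpow hG.toIsGarsideSystem j).decycling_elt hG.toIsGarsideSystem]

theorem gridElt_natCast (i : ℕ) (j : ℤ) :
    gridElt Δ p l σ i j = (cycling S Δ)^[i] ((tau Δ ^ j) (elt Δ p l σ 0)) := by
  induction i with
  | zero => rfl
  | succ n ih => rw [Function.iterate_succ_apply', ← ih, h.cycling_gridElt hG, Nat.cast_succ]

/-- For `i ≥ 0`, iterated cycling transports the period from row zero. Other rows reduce to this by
whole laps, which shift `j` and `k` equally. -/
theorem gridElt_congr_right (i : ℤ) {j k : ℤ} (hjk : (ord Δ (elt Δ p l σ 0) : ℤ) ∣ j - k) :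
    gridElt Δ p l σ i j = gridElt Δ p l σ i k := by
  have key (n : ℕ) {j k : ℤ} (hjk : (ord Δ (elt Δ p l σ 0) : ℤ) ∣ j - k) :
      gridElt Δ p l σ n j = gridElt Δ p l σ n k := by
    rw [h.gridElt_natCast hG, h.gridElt_natCast hG, tau_zpow_eq_of_dvd hjk]
  have hl : (0 : ℤ) < l := by exact_mod_cast h.pos
  have e (j : ℤ) : gridElt Δ p l σ i j =
      gridElt Δ p l σ (i % l).toNat (j - p * (i / l)) := by
    rw [Int.toNat_of_nonneg (Int.emod_nonneg i hl.ne'), ← h.gridElt_add_mul_left,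
      Int.emod_add_mul_ediv]
  rw [e, e, key]
  simpa using hjk

theorem gridElt_congr_left {b : G} (hb : elt Δ p l σ 0 = b) (hl : cl S Δ b = l)
    (hp : infimum S Δ b = p) {i k : ℤ} (j : ℤ) (hik : (rows S Δ b : ℤ) ∣ i - k) :
    gridElt Δ p l σ i j = gridElt Δ p l σ k j := by
  -- Thus `n` laps move the column by `-p * n`, a multiple of the period of `τ` on `b`.
  obtain ⟨n, hn, hpn⟩ : ∃ n : ℕ, rows S Δ b = l * n ∧ (ord Δ b : ℤ) ∣ p * n := by
    rw [rows, hl, hp]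
    split_ifs with h0
    · exact ⟨1, by simp, by simp [h0]⟩
    · refine ⟨_, rfl, ?_⟩
      rw [← Int.dvd_natAbs, Int.natAbs_mul, Int.natAbs_natCast, Int.natCast_dvd_natCast,
        Nat.mul_div_cancel' (Nat.dvd_lcm_left _ _)]
      exact Nat.dvd_lcm_right _ _
  obtain ⟨c, hc⟩ := hik
  have e : i = k + l * (n * c) := by
    rw [hn] at hc
    push_cast at hc
    linarith
  rw [e, h.gridElt_add_mul_left]
  apply h.gridElt_congr_right hG
  rw [hb]
  have : j - p * (n * c) - j = p * n * (-c) := by ring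
  rw [this]
  exact hpn.mul_right _

theorem gridElt_bounds (i j : ℤ) :
    LeftLE S (Δ ^ p) (gridElt Δ p l σ i j) ∧
      LeftLE S (gridElt Δ p l σ i j) (Δ ^ (p + l)) := by
  rw [gridElt_eq_elt]
  have := h.tau_zpow hG.toIsGarsideSystem j
  exact ⟨this.delta_zpow_leftLE_elt hG.toIsGarsideSystem i,
    this.elt_leftLE_delta_zpow hG.toIsGarsideSystem i⟩

theorem conj_firstFactor (i j : ℤ) :
    (tau Δ ^ (-p)) (firstFactor S Δ (gridElt Δ p l σ i j)) ∈ S ∧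
    ((tau Δ ^ (-p)) (firstFactor S Δ (gridElt Δ p l σ i j)))⁻¹ * gridElt Δ p l σ i j *
      (tau Δ ^ (-p)) (firstFactor S Δ (gridElt Δ p l σ i j)) = gridElt Δ p l σ (i + 1) j := by
  have hj := h.tau_zpow hG.toIsGarsideSystem j
  rw [gridElt_eq_elt, gridElt_eq_elt, hj.firstFactor_elt hG.toIsGarsideSystem, ← hj.periodic i]
  exact ⟨hj.mem _, hj.conj_next i⟩

theorem conj_compl_lastFactor (i j : ℤ) :
    compl Δ (lastFactor S Δ (gridElt Δ p l σ i j)) ∈ S ∧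
    (compl Δ (lastFactor S Δ (gridElt Δ p l σ i j)))⁻¹ * gridElt Δ p l σ i j *
      compl Δ (lastFactor S Δ (gridElt Δ p l σ i j)) = gridElt Δ p l σ (i - 1) (j + 1) := by
  have hj := h.tau_zpow hG.toIsGarsideSystem j
  rw [gridElt_add_one_right, gridElt_eq_elt, gridElt_eq_elt]
  obtain ⟨i, rfl⟩ : ∃ k, i = k + 1 := ⟨i - 1, by ring⟩
  rw [hj.lastFactor_elt hG.toIsGarsideSystem, add_sub_cancel_right]
  exact ⟨hG.compl_mem (hj.mem _), hj.conj_compl i⟩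

theorem label_cases_gridElt {i j : ℤ} {s : G} (hs : s ∈ S)
    (h₁ : LeftLE S (Δ ^ p) (s⁻¹ * gridElt Δ p l σ i j * s))
    (h₂ : LeftLE S (s⁻¹ * gridElt Δ p l σ i j * s) (Δ ^ (p + l))) :
    s = 1 ∨ s = Δ ∨ s = (tau Δ ^ (-p)) (firstFactor S Δ (gridElt Δ p l σ i j)) ∨
      s = compl Δ (lastFactor S Δ (gridElt Δ p l σ i j)) := by
  have hj := h.tau_zpow hG.toIsGarsideSystem j
  rw [gridElt_eq_elt] at h₁ h₂ ⊢
  obtain ⟨i, rfl⟩ : ∃ k, i = k + 1 := ⟨i - 1, by ring⟩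
  rw [hj.lastFactor_elt hG.toIsGarsideSystem, hj.firstFactor_elt hG.toIsGarsideSystem,
    ← hj.periodic]
  obtain ⟨n, rfl⟩ := Nat.exists_eq_add_one.2 h.pos
  have := hj.label_cases hG hs h₁ h₂
  rwa [show i + 1 + n = i + ((n + 1 : ℕ) : ℤ) by push_cast; ring,
    show i + ((n + 1 : ℕ) : ℤ) + 1 = i + 1 + ((n + 1 : ℕ) : ℤ) by ring] at this

/-- The conjugates of `b` in `[Δ ^ p, Δ ^ (p + l)]` are the elements of the grid. -/
theorem mem_range_gridElt_iff {x : G} :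
    (∃ i j, gridElt Δ p l σ i j = x) ↔ IsConj (elt Δ p l σ 0) x ∧
      LeftLE S (Δ ^ p) x ∧ LeftLE S x (Δ ^ (p + l)) := by
  constructor
  · rintro ⟨i, j, rfl⟩
    refine ⟨?_, h.gridElt_bounds hG i j⟩
    rw [gridElt, tau_zpow_conj]
    induction i with
    | zero => rfl
    | succ n ih =>
      rw [← h.conj_next, isConj_conj]
      exact ih
    | pred n ih =>
      have := h.conj_next (-(n : ℤ) - 1)
      rw [sub_add_cancel] at this
      rwa [← this, isConj_conj] at ih
  · rintro ⟨hx, h₁, h₂⟩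
    obtain ⟨c, rfl⟩ := isConj_iff.1 hx
    -- The conjugator splits as `Δ ^ k * g`: the first part acts as `τ ^ k`, inside the grid, and
    -- `g` is positive, so connectedness applies.
    obtain ⟨k, g, hg, hk⟩ := hG.exists_delta_zpow_leftLE c⁻¹
    have e : c * elt Δ p l σ 0 * c⁻¹ = g⁻¹ * gridElt Δ p l σ 0 k * g := by
      rw [gridElt, tau_zpow_apply, ← inv_inv c, hk]
      group
    rw [e] at h₁ h₂ ⊢
    refine hG.conj_mem_of_simple_conj_mem (A := {x | ∃ i j, gridElt Δ p l σ i j = x})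
      (p := p) (q := p + l) ?_ ?_ hg ⟨0, k, rfl⟩ h₁ h₂
    · rintro _ ⟨i, j, rfl⟩
      exact h.gridElt_bounds hG i j
    · rintro _ ⟨i, j, rfl⟩ s hs h₁ h₂
      rcases h.label_cases_gridElt hG hs h₁ h₂ with h₃ | h₃ | h₃ | h₃
      · exact ⟨i, j, by simp [h₃]⟩
      · exact ⟨i, j + 1, by rw [h₃, conj_delta_gridElt]⟩
      · exact ⟨i + 1, j, by rw [h₃, (h.conj_firstFactor hG i j).2]⟩
      · exact ⟨i - 1, j + 1, by rw [h₃, (h.conj_compl_lastFactor hG i j).2]⟩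

end RigidSeq

theorem rows_pos {b : G} (hl : 0 < cl S Δ b) (hr : 0 < ord Δ b) : 0 < rows S Δ b := by
  rw [rows]
  split_ifs with h0
  · exact hl
  · have hp := Int.natAbs_pos.2 h0
    exact Nat.mul_pos hl (Nat.div_pos
      (Nat.le_of_dvd (Nat.lcm_pos hp hr) (Nat.dvd_lcm_left _ _)) hp)

end Grid

end Garside

/-! ### The main theorem: descent to the torus, and counting. -/

theorem mainTheorem5 {G : Type*} [Group G] (S : Set G) (Δ : G)
    (hG : Garside.IsSpindle S Δ) (b : G) (hb : b ∈ Garside.SSS S Δ b)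
    (hl : 1 ≤ Garside.cl S Δ b)
    (hrigid : Garside.cl S Δ b = 1 → Garside.IsRigid S Δ b) :
    0 < Garside.ord Δ b ∧ 0 < Garside.rows S Δ b ∧
    (∃ φ : ZMod (Garside.rows S Δ b) × ZMod (Garside.ord Δ b) → G,
      -- the vertices: `φ (i, j) = c^i (τ^j b)`, and every element of the SSS occurs
      (∀ i j : ℕ, φ ((i : ZMod (Garside.rows S Δ b)), (j : ZMod (Garside.ord Δ b))) =
        (Garside.cycling S Δ)^[i] ((Garside.tau Δ ^ j) b)) ∧
      Set.range φ = Garside.SSS S Δ b ∧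
      -- vertical arrows are cyclings, their inverses are decyclings, horizontal arrows are `τ`
      (∀ i j, φ (i + 1, j) = Garside.cycling S Δ (φ (i, j)) ∧
        φ (i, j) = Garside.decycling S Δ (φ (i + 1, j)) ∧
        φ (i, j + 1) = Garside.tau Δ (φ (i, j))) ∧
      -- going down `l` rows is the same as going `p` columns to the left
      (∀ i j, φ (i + (Garside.cl S Δ b : ZMod (Garside.rows S Δ b)), j) =
        φ (i, j - (Garside.infimum S Δ b : ZMod (Garside.ord Δ b)))) ∧
      -- the arrows of the SSS-graph: the trivial loops, the images of the horizontal and of the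
      -- vertical arrows, and the reversed vertical arrows (decyclings) followed by a horizontal one
      (∀ i j, ∀ s y : G, Garside.SSSArrow S Δ b (φ (i, j)) s y ↔
        (s = 1 ∧ y = φ (i, j)) ∨
        (s = Δ ∧ y = φ (i, j + 1)) ∨
        (s = (Garside.tau Δ ^ (-Garside.infimum S Δ b)) (Garside.firstFactor S Δ (φ (i, j))) ∧
          y = φ (i + 1, j)) ∨
        (s = Garside.compl Δ (Garside.lastFactor S Δ (φ (i, j))) ∧ y = φ (i - 1, j + 1)))) ∧
    (Garside.SSS S Δ b).Finite ∧
    (Garside.SSS S Δ b).ncard ≤ Garside.cl S Δ b * Garside.ord Δ b := by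
  classical
  open Garside in
  have hG' := hG.toIsGarsideSystem
  obtain ⟨σ, h, hσ⟩ := hG.exists_rigidSeq hb hl hrigid
  have hΔ := h.ne_one_delta hG'
  have hF : factors S Δ b ≠ [] := by
    intro h0
    simp [cl, h0] at hl
  have hr := hG.ord_pos b
  have hm : 0 < rows S Δ b := rows_pos hl hr
  have hmem : ∀ x, x ∈ SSS S Δ b ↔
      ∃ i j, gridElt Δ (infimum S Δ b) (cl S Δ b) σ i j = x := fun x => by
    rw [hG.mem_SSS_iff hb hΔ, hG.supremum_eq_infimum_add_cl hΔ hF,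
      h.mem_range_gridElt_iff hG, hσ]
  obtain ⟨φ, hφ⟩ : ∃ φ : ZMod (rows S Δ b) × ZMod (ord Δ b) → G, ∀ i j : ℤ,
      φ ((i : ZMod (rows S Δ b)), (j : ZMod (ord Δ b))) =
        gridElt Δ (infimum S Δ b) (cl S Δ b) σ i j := by
    -- Arbitrary integer representatives are chosen; the two periods make the value independent of
    -- the choice.
    refine ⟨fun u => gridElt Δ (infimum S Δ b) (cl S Δ b) σ
      (Function.surjInv ZMod.intCast_surjective u.1)
      (Function.surjInv ZMod.intCast_surjective u.2), fun i j => ?_⟩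
    refine (h.gridElt_congr_left hG hσ rfl rfl _ ?_).trans (h.gridElt_congr_right hG i ?_)
    · rw [← ZMod.intCast_eq_intCast_iff_dvd_sub]
      exact (Function.surjInv_eq ZMod.intCast_surjective _).symm
    · rw [hσ, ← ZMod.intCast_eq_intCast_iff_dvd_sub]
      exact (Function.surjInv_eq ZMod.intCast_surjective _).symm
  have hφ' (i : ZMod (rows S Δ b)) (j : ZMod (ord Δ b)) :
      ∃ i' j' : ℤ, (i' : ZMod (rows S Δ b)) = i ∧ (j' : ZMod (ord Δ b)) = j :=
    ⟨_, _, (ZMod.intCast_surjective i).choose_spec, (ZMod.intCast_surjective j).choose_spec⟩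
  have hsub (y : G) : (∃ i j, gridElt Δ (infimum S Δ b) (cl S Δ b) σ i j = y) ↔ ∃ u, φ u = y := by
    constructor
    · rintro ⟨i, j, rfl⟩
      exact ⟨_, hφ i j⟩
    · rintro ⟨⟨i, j⟩, rfl⟩
      obtain ⟨i, j, rfl, rfl⟩ := hφ' i j
      exact ⟨i, j, (hφ i j).symm⟩
  refine ⟨hr, hm, ⟨φ, fun i j => ?_, ?_, fun i j => ?_, fun i j => ?_, fun i j s y => ?_⟩, ?_⟩
  · have := hφ i j
    rw [h.gridElt_natCast hG, hσ] at this
    simpa using this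
  · ext y
    rw [hmem, hsub, Set.mem_range]
  · obtain ⟨i, j, rfl, rfl⟩ := hφ' i j
    have h₁ := hφ (i + 1) j
    have h₂ := hφ i (j + 1)
    push_cast at h₁ h₂
    rw [h₁, h₂, hφ, h.cycling_gridElt hG, h.decycling_gridElt hG, gridElt_add_one_right]
    exact ⟨rfl, rfl, rfl⟩
  · obtain ⟨i, j, rfl, rfl⟩ := hφ' i j
    have h₁ := hφ (i + cl S Δ b) j
    have h₂ := hφ i (j - infimum S Δ b)
    push_cast at h₁ h₂
    rw [h₁, h₂, h.gridElt_add_left]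
  · obtain ⟨i, j, rfl, rfl⟩ := hφ' i j
    have h₁ := hφ (i + 1) j
    have h₂ := hφ i (j + 1)
    have h₃ := hφ (i - 1) (j + 1)
    push_cast at h₁ h₂ h₃
    rw [h₁, h₂, h₃, hφ, SSSArrow]
    constructor
    · rintro ⟨-, hy, hs, rfl⟩
      obtain ⟨hy₁, hy₂⟩ := ((h.mem_range_gridElt_iff hG).1 ((hmem _).1 hy)).2
      rcases h.label_cases_gridElt hG hs hy₁ hy₂ with hs | hs | hs | hs
      · exact .inl ⟨hs, by simp [hs]⟩
      · exact .inr (.inl ⟨hs, by rw [hs, conj_delta_gridElt]⟩)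
      · exact .inr (.inr (.inl ⟨hs, by rw [hs, (h.conj_firstFactor hG i j).2]⟩))
      · exact .inr (.inr (.inr ⟨hs, by rw [hs, (h.conj_compl_lastFactor hG i j).2]⟩))
    · have hin (i j : ℤ) : gridElt Δ (infimum S Δ b) (cl S Δ b) σ i j ∈ SSS S Δ b :=
        (hmem _).2 ⟨i, j, rfl⟩
      rintro (⟨rfl, rfl⟩ | ⟨rfl, rfl⟩ | ⟨rfl, rfl⟩ | ⟨rfl, rfl⟩)
      · exact ⟨hin _ _, hin _ _, hG.one_mem, by simp⟩
      · exact ⟨hin _ _, hin _ _, hG.delta_mem_simples, (conj_delta_gridElt _ _ _ i j).symm⟩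
      · obtain ⟨hs, hc⟩ := h.conj_firstFactor hG i j
        exact ⟨hin _ _, hin _ _, hs, hc.symm⟩
      · obtain ⟨hs, hc⟩ := h.conj_compl_lastFactor hG i j
        exact ⟨hin _ _, hin _ _, hs, hc.symm⟩
  · have hl' : (0 : ℤ) < cl S Δ b := by exact_mod_cast hl
    have hr' : (0 : ℤ) < ord Δ b := by exact_mod_cast hr
    -- An `l × r` rectangle suffices instead of `m × r`: whole laps in `i` are absorbed into `j`,
    -- which is then reduced modulo `r`.
    let T : Finset G := (Finset.range (cl S Δ b) ×ˢ Finset.range (ord Δ b)).image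
      fun u => gridElt Δ (infimum S Δ b) (cl S Δ b) σ u.1 u.2
    have hcover : SSS S Δ b ⊆ T := by
      intro y hy
      obtain ⟨i, j, rfl⟩ := (hmem y).1 hy
      have hi := Int.emod_nonneg i hl'.ne'
      have hi' := Int.emod_lt_of_pos i hl'
      have hj := Int.emod_nonneg (j - infimum S Δ b * (i / cl S Δ b)) hr'.ne'
      have hj' := Int.emod_lt_of_pos (j - infimum S Δ b * (i / cl S Δ b)) hr'
      refine Finset.mem_coe.2 (Finset.mem_image.2 ⟨((i % cl S Δ b).toNat,
        ((j - infimum S Δ b * (i / cl S Δ b)) % ord Δ b).toNat), ?_, ?_⟩)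
      · rw [Finset.mem_product, Finset.mem_range, Finset.mem_range]
        dsimp only
        omega
      · dsimp only
        rw [Int.toNat_of_nonneg hi, Int.toNat_of_nonneg hj]
        conv_rhs => rw [← Int.emod_add_mul_ediv i (cl S Δ b), h.gridElt_add_mul_left]
        refine h.gridElt_congr_right hG _ ?_
        rw [hσ, ← neg_sub, dvd_neg]
        exact Int.dvd_self_sub_emod
    refine ⟨T.finite_toSet.subset hcover, (Set.ncard_le_ncard hcover T.finite_toSet).trans ?_⟩
    rw [Set.ncard_coe_finset]
    exact Finset.card_image_le.trans (by simp)
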